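/- Let $G=(V,E)$ be a finite directed acyclic graph, let $i\ne j$ be vertices and let $K\subseteq V\setminus\{i,j\}$ be such that $K$ does not $d$-separate $i$ from $j$, i.e. there is a path of distinct vertices from $i$ to $j$ (edges in either direction) whose noncolliders are not in $K$ and whose colliders are in $K$ or have a descendant in $K$. A trek $T=(P_L,P_R)$ from $u$ to $v$ is a pair of directed paths (possibly without edges) from a common vertex $s$, with $P_L$ ending in $u$ (the leftmost vertex of $T$) and $P_R$ ending in $v$ (the rightmost vertex); its monomial is $m_T=\omega_s\prod_{k\to l\in P_L}\lambda_{kl}\prod_{k\to l\in P_R}\lambda_{kl}$ in the polynomial ring $\mathbb{R}[\Lambda,\Omega]$ with one variable $\omega_v$ for each $v\in V$ and one variable $\lambda_{kl}$ for each edge $k\to l$. Let $\Sigma=(\sigma_{uv})$ be the symmetric matrix of indeterminates indexed by $V$, and let $\phi:\mathbb{R}[\Sigma]\to\mathbb{R}[\Lambda,\Omega]$ be the $\mathbb{R}$-algebra homomorphism with $\phi(\sigma_{uv})=\sum_T m_T$, the sum over all treks $T$ from $u$ to $v$. A trek system from $A$ to $B$, where $|A|=|B|=k$, is a set $\mathbf{T}$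 of $k$ treks whose leftmost vertices exhaust $A$ and whose rightmost vertices exhaust $B$; its monomial is $m_{\mathbf{T}}=\prod_{T\in\mathbf{T}}m_T$, and it has no sided intersection if the left parts $P_L$ of its treks are mutually vertex-disjoint and so are the right parts $P_R$. Then $\phi(\det\Sigma_{\{i\}\cup K,\{j\}\cup K})$ is a monomial (times a nonzero scalar) if and only if there is a unique trek system from $\{i\}\cup K$ to $\{j\}\cup K$ with no sided intersection. Moreover, if $\mathbf{T}\neq\mathbf{T}'$ are two such trek systems with no sided intersection and $m_{\mathbf{T}}=m_{\mathbf{T}'}$, then there is a trek system $\mathbf{T}''$ from $\{i\}\cup K$ to $\{j\}\cup K$ with no sided intersection and $m_{\mathbf{T}''}\neq m_{\mathbf{T}}$. -/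

import Mathlib

/-- A directed graph is acyclic (a DAG) if no vertex can be reached from itself by a nonempty
sequence of edges. In particular there are no loops and at most one edge between two vertices. -/
def IsDAG {V : Type*} (G : Digraph V) : Prop :=
  ∀ v : V, ¬ Relation.TransGen G.Adj v v

/-! ### Paths and d-separation -/

/-- `p` is a (not necessarily directed) path from `u` to `v`: a sequence of distinct vertices in
which consecutive vertices are joined by an edge, in either direction. -/
def IsUndirPath {V : Type*} (G : Digraph V) (u v : V) (p : List V) : Prop :=
  p.IsChain (fun a b => G.Adj a b ∨ G.Adj b a) ∧ p.Nodup ∧ p.head? = some u ∧ p.getLast? = some v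

/-- `p` is a directed path from `u` to `v`: a sequence of distinct vertices in which each vertex
has an edge to the next one. The path `[u]` without edges is a directed path from `u` to `u`. -/
def IsDirPath {V : Type*} (G : Digraph V) (u v : V) (p : List V) : Prop :=
  p.IsChain G.Adj ∧ p.Nodup ∧ p.head? = some u ∧ p.getLast? = some v

/-- `k` is a collider on the path `p` if `p` contains consecutive edges `a → k` and `k ← b`. -/
def IsCollider {V : Type*} (G : Digraph V) (p : List V) (k : V) : Prop :=
  ∃ a b : V, [a, k, b] <:+: p ∧ G.Adj a k ∧ G.Adj b k

/-- `d` is a descendant of `k`. -/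
def IsDescendant {V : Type*} (G : Digraph V) (k d : V) : Prop :=
  ∃ p : List V, IsDirPath G k d p

/-- `C` d-separates `A` and `B`: every path between a vertex of `A` and a vertex of `B` contains a
noncollider in `C`, or a collider that is not in `C` and has no descendant in `C`. -/
def DSeparates {V : Type*} (G : Digraph V) (A B C : Set V) : Prop :=
  ∀ u ∈ A, ∀ v ∈ B, ∀ p : List V, IsUndirPath G u v p →
    ∃ k ∈ p, (¬ IsCollider G p k ∧ k ∈ C) ∨
      (IsCollider G p k ∧ k ∉ C ∧ ∀ d ∈ C, ¬ IsDescendant G k d)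

/-! ### Treks and trek systems -/

/-- A trek `(P_L, P_R)`: two directed paths that start at the same vertex `top`; the left one
ends at `leftmost` and the right one ends at `rightmost`. -/
@[ext]
structure Trek {V : Type*} (G : Digraph V) where
  top : V
  leftmost : V
  rightmost : V
  left : List V
  right : List V
  left_path : IsDirPath G top leftmost left
  right_path : IsDirPath G top rightmost right

/-- The trek read from right to left. -/
def Trek.swap {V : Type*} {G : Digraph V} (T : Trek G) : Trek G :=
  ⟨T.top, T.rightmost, T.leftmost, T.right, T.left, T.right_path, T.left_path⟩

/-- A finite graph has finitely many treks. -/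
instance Trek.instFinite {V : Type*} [Finite V] (G : Digraph V) : Finite (Trek G) := by
  classical
  have := Fintype.ofFinite V
  let f : Trek G → V × V × V × {l : List V // l.Nodup} × {l : List V // l.Nodup} :=
    fun T => (T.top, T.leftmost, T.rightmost, ⟨T.left, T.left_path.2.1⟩,
      ⟨T.right, T.right_path.2.1⟩)
  refine Finite.of_injective f ?_
  intro S T h
  simp only [f, Prod.mk.injEq, Subtype.mk.injEq] at h
  exact Trek.ext h.1 h.2.1 h.2.2.1 h.2.2.2.1 h.2.2.2.2

/-- The treks from `u` to `v`. -/
def TrekBetween {V : Type*} (G : Digraph V) (u v : V) : Type _ :=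
  {T : Trek G // T.leftmost = u ∧ T.rightmost = v}

noncomputable instance TrekBetween.instFintype {V : Type*} [Finite V] (G : Digraph V) (u v : V) :
    Fintype (TrekBetween G u v) :=
  @Fintype.ofFinite _ (Subtype.finite (p := fun T : Trek G => T.leftmost = u ∧ T.rightmost = v))

/-- The set `𝒯` of treks is a trek system from `A` to `B`, two vertex sets with the same number
`k` of elements: it consists of `k` treks, their leftmost vertices exhaust `A` and their
rightmost vertices exhaust `B`. -/
def IsTrekSystem {V : Type*} {G : Digraph V} (A B : Finset V) (𝒯 : Finset (Trek G)) : Prop :=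
  𝒯.card = A.card ∧ 𝒯.card = B.card ∧
    Trek.leftmost '' (𝒯 : Set (Trek G)) = (A : Set V) ∧
    Trek.rightmost '' (𝒯 : Set (Trek G)) = (B : Set V)

/-- The left parts of the treks in `𝒯` are mutually vertex-disjoint, and so are the right parts. -/
def NoSidedIntersection {V : Type*} {G : Digraph V} (𝒯 : Finset (Trek G)) : Prop :=
  ∀ S ∈ 𝒯, ∀ T ∈ 𝒯, S ≠ T → List.Disjoint S.left T.left ∧ List.Disjoint S.right T.right

/-! ### The polynomial rings and the trek rule -/

/-- The indeterminates of `ℝ[Λ, Ω]`: one `ω_v` for each vertex, one `λ_{kl}` for each edge. -/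
inductive Param {V : Type*} (G : Digraph V) : Type _ where
  | omega (v : V) : Param G
  | lambda (k l : V) (h : G.Adj k l) : Param G

/-- The entry `λ_{kl}` of `Λ`: an indeterminate if `k → l` is an edge and `0` otherwise. -/
noncomputable def edgeWeight {V : Type*} (G : Digraph V) (k l : V) : MvPolynomial (Param G) ℝ :=
  open Classical in
  if h : G.Adj k l then MvPolynomial.X (Param.lambda k l h) else 0

/-- The product of the `λ_{kl}` over the edges `k → l` of a directed path. -/
noncomputable def pathMonomial {V : Type*} (G : Digraph V) (p : List V) :
    MvPolynomial (Param G) ℝ :=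
  ((p.zip p.tail).map fun e => edgeWeight G e.1 e.2).prod

/-- The trek monomial `m_T`. -/
noncomputable def Trek.weight {V : Type*} {G : Digraph V} (T : Trek G) :
    MvPolynomial (Param G) ℝ :=
  MvPolynomial.X (Param.omega T.top) * pathMonomial G T.left * pathMonomial G T.right

/-- The trek system monomial, the product of the trek monomials. -/
noncomputable def trekSystemWeight {V : Type*} {G : Digraph V} (𝒯 : Finset (Trek G)) :
    MvPolynomial (Param G) ℝ :=
  ∏ T ∈ 𝒯, T.weight

/-- The sum of the trek monomials over all treks from `u` to `v`. -/
noncomputable def trekSum {V : Type*} [Finite V] (G : Digraph V) (u v : V) :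
    MvPolynomial (Param G) ℝ :=
  ∑ T : TrekBetween G u v, T.1.weight

/-- Reading treks from right to left matches the treks from `u` to `v` with those from `v` to
`u`. -/
def TrekBetween.swapEquiv {V : Type*} (G : Digraph V) (u v : V) :
    TrekBetween G u v ≃ TrekBetween G v u where
  toFun T := ⟨T.1.swap, T.2.2, T.2.1⟩
  invFun T := ⟨T.1.swap, T.2.2, T.2.1⟩
  left_inv _ := rfl
  right_inv _ := rfl

theorem trekSum_comm {V : Type*} [Finite V] (G : Digraph V) (u v : V) :
    trekSum G u v = trekSum G v u := by
  unfold trekSum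
  refine Fintype.sum_equiv (TrekBetween.swapEquiv G u v) _ _ fun T => ?_
  exact mul_right_comm _ _ _

/-- The ring homomorphism `φ_G^*` from `ℝ[Σ]` to `ℝ[Λ, Ω]` that sends the covariance `σ_{uv}`,
indexed by the unordered pair `{u, v}`, to the sum of the monomials of the treks from `u` to
`v`. -/
noncomputable def phiStar {V : Type*} [Finite V] (G : Digraph V) :
    MvPolynomial (Sym2 V) ℝ →ₐ[ℝ] MvPolynomial (Param G) ℝ :=
  MvPolynomial.aeval (Sym2.lift ⟨trekSum G, trekSum_comm G⟩)

/-- The symmetric matrix `Σ` of indeterminates `σ_{uv}`. -/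
noncomputable def sigmaMatrix (V : Type*) : Matrix V V (MvPolynomial (Sym2 V) ℝ) :=
  Matrix.of fun u v => MvPolynomial.X s(u, v)

/-- The determinant of the submatrix `Σ_{iK,jK}`, with rows `i, K` and columns `j, K`. The index
`none` stands for `i` in the rows and for `j` in the columns. -/
noncomputable def detSigma {V : Type*} [DecidableEq V] (i j : V) (K : Finset V) :
    MvPolynomial (Sym2 V) ℝ :=
  ((sigmaMatrix V).submatrix
    (fun a : Option K => a.elim i Subtype.val)
    (fun b : Option K => b.elim j Subtype.val)).det

/-- `f` is a monomial, up to a nonzero scalar: it has exactly one term. -/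
def IsMonomialTerm {σ : Type*} (f : MvPolynomial σ ℝ) : Prop :=
  ∃ (s : σ →₀ ℕ) (c : ℝ), c ≠ 0 ∧ f = MvPolynomial.monomial s c

/-! Let $\Lambda$ be the matrix of edge variables, $P=(1-\Lambda)^{-1}$ the matrix of path sums and
$\Omega$ the diagonal matrix of the $\omega_v$. The trek rule says $\phi(\Sigma)=P^T\Omega P$. Put
$A=\{i\}\cup K$ and $B=\{j\}\cup K$. By Cauchy–Binet, $\phi(\det\Sigma_{A,B})$ is the sum, over the
sets $S$ of $|A|$ top vertices, of $\prod_{s\in S}\omega_s$ times the two minors of $P$ with rows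
$S$ and columns $A$, respectively $B$.

Each minor is a signed sum over families of disjoint directed paths, as in the
Lindström–Gessel–Viennot lemma, but no sign-reversing involution is used. Up to the unit $\det P$,
the minor is the determinant of $1-\Lambda$ with the rows in $A$ replaced by unit vectors at $S$.
The permutations with a nonzero Leibniz term are those that send $A$ to $S$ in the prescribed way
and otherwise fix a vertex or follow an edge. Forgetting the values on $A$ leaves a map $f$ that
restricts to a bijection $A^c\to S^c$, an `IsLinkage`. Injectivity keeps its trails apart, no trail
returns to $S$, and acyclicity excludes cycles, so the trails from $S$ are disjoint paths onto $A$
(`det_pathSum_submatrix`).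

The monomial of a linkage determines it, because $\lambda_{vw}$ occurs exactly when $f(v)=w$
(`AlongEdges.edgeExponent_inj`). Hence nothing cancels inside a minor. It vanishes iff there is no
linkage, and it is a single term iff the linkage is unique. In the product of two minors several
pairs $(f,g)$ may share a monomial, but over a domain a product is a single term iff both factors
are. Different $S$ are told apart by their $\omega$-degrees. So the determinant is a single term iff
exactly one triple $(S,f,g)$ exists.

Trek systems without sided intersection are the same as such triples: $S$ is the set of tops, $f$
gives the left parts and $g$ the right parts (`exists_encoding`, `exists_encodes`). The second claim
follows by recombination. Systems of equal weight share $S$, and if $(f,g)\ne(f',g')$, the system of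
$(S,f,g')$ has a different weight. -/

/-! ### Determinants -/

/-- The Cauchy–Binet formula; `e S` enumerates the set `S`. -/
theorem det_mul_eq_sum_powersetCard {R ι V : Type*} [CommRing R] [Fintype ι] [DecidableEq ι]
    [Fintype V] [DecidableEq V] (e : Finset V → ι → V)
    (he : ∀ S : Finset V, S.card = Fintype.card ι →
      Function.Injective (e S) ∧ Finset.univ.image (e S) = S)
    (X : Matrix ι V R) (Y : Matrix V ι R) :
    (X * Y).det = ∑ S ∈ Finset.powersetCard (Fintype.card ι) (Finset.univ : Finset V),
      (X.submatrix id (e S)).det * (Y.submatrix (e S) id).det := by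
  -- Each row of the product is a combination of the rows of `Y`, so multilinearity expands the
  -- determinant over all maps `f`.
  have h1 : (X * Y).det = ∑ f : ι → V, (∏ k, X k (f k)) * (Y.submatrix f id).det := by
    have h := (Matrix.detRowAlternating (R := R) (n := ι)).toMultilinearMap.map_sum
      (fun (k : ι) (v : V) => X k v • Y v)
    have h2 : (fun k => ∑ v, X k v • Y v) = X * Y := by
      ext k l
      simp [Matrix.mul_apply]
    rw [h2] at h
    refine h.trans (Finset.sum_congr rfl fun f _ => ?_)
    exact (Matrix.detRowAlternating (R := R) (n := ι)).toMultilinearMap.map_smul_univ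
      (fun k => X k (f k)) (fun k => Y (f k))
  -- Maps are grouped by image. Those with image `S` of full size are `e S` composed with a
  -- permutation; the others repeat a row of `Y`.
  rw [h1, ← Finset.sum_fiberwise (Finset.univ : Finset (ι → V)) (fun f => Finset.univ.image f)]
  rw [← Finset.sum_subset (Finset.subset_univ
    (Finset.powersetCard (Fintype.card ι) (Finset.univ : Finset V)))]
  · refine Finset.sum_congr rfl fun S hS => ?_
    obtain ⟨hinj, him⟩ := he S (Finset.mem_powersetCard.1 hS).2
    have hterm : ∀ τ : Equiv.Perm ι, (Y.submatrix (e S ∘ τ) id).det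
        = Equiv.Perm.sign τ * (Y.submatrix (e S) id).det := fun τ =>
      Matrix.det_permute τ (Y.submatrix (e S) id)
    rw [← Matrix.det_transpose (X.submatrix id (e S)), Matrix.det_apply', Finset.sum_mul]
    symm
    refine Finset.sum_bij (fun τ _ => e S ∘ τ) ?_ ?_ ?_ ?_
    · intro τ _
      simp only [Finset.mem_filter, Finset.mem_univ, true_and]
      conv_rhs => rw [← him]
      ext v
      simp only [Finset.mem_image, Finset.mem_univ, true_and, Function.comp]
      exact ⟨fun ⟨k, hk⟩ => ⟨τ k, hk⟩, fun ⟨k, hk⟩ => ⟨τ.symm k, by simpa using hk⟩⟩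
    · intro τ _ τ' _ h
      ext k
      exact hinj (congrFun h k)
    · intro f hf
      simp only [Finset.mem_filter, Finset.mem_univ, true_and] at hf
      have hfi : Function.Injective f := by
        rw [← Set.injOn_univ, ← Finset.coe_univ, ← Finset.card_image_iff, hf,
          (Finset.mem_powersetCard.1 hS).2, Finset.card_univ]
      have hex : ∀ k, ∃ l, e S l = f k := fun k => by
        have : f k ∈ Finset.univ.image (e S) := by
          rw [him, ← hf]; exact Finset.mem_image_of_mem _ (Finset.mem_univ k)
        simpa using this
      choose t ht using hex
      have hti : Function.Injective t := fun k l h => hfi (by rw [← ht, ← ht, h])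
      refine ⟨Equiv.ofBijective t (Finite.injective_iff_bijective.1 hti), Finset.mem_univ _, ?_⟩
      funext k
      exact ht k
    · intro τ _
      simp only [hterm, Matrix.transpose_apply, Matrix.submatrix_apply, id, Function.comp]
      ring
  · intro S _ hS
    refine Finset.sum_eq_zero fun f hf => ?_
    have hnot : ¬ Function.Injective f := by
      intro hfi
      refine hS (Finset.mem_powersetCard.2 ⟨Finset.subset_univ _, ?_⟩)
      rw [← (Finset.mem_filter.1 hf).2, Finset.card_image_of_injective _ hfi, Finset.card_univ]
    simp only [Function.Injective, not_forall] at hnot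
    obtain ⟨k, l, hkl, hne⟩ := hnot
    rw [Matrix.det_zero_of_row_eq hne, mul_zero]
    ext m
    simp [hkl]

/-- A minor of the inverse `P` of a matrix `M`, as the determinant of the matrix `N` obtained from
`M` by replacing some rows by unit vectors. -/
theorem det_submatrix_of_mul_eq_one {R ι V : Type*} [CommRing R] [Fintype ι] [DecidableEq ι]
    [Fintype V] [DecidableEq V] {M P N : Matrix V V R} (h : M * P = 1) {e a : ι → V}
    (ha : Function.Injective a) (hN : ∀ k, N (a k) = Pi.single (e k) 1)
    (hN' : ∀ v, v ∉ Set.range a → N v = M v) :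
    (P.submatrix e a).det = N.det * P.det := by
  classical
  rw [← Matrix.det_mul]
  have h1 : ∀ k w, (N * P) (a k) w = P (e k) w := fun k w => by
    rw [Matrix.mul_apply, Finset.sum_eq_single (e k)]
    · simp [hN]
    · intro v _ hv
      simp [hN, hv]
    · simp
  have h2 : ∀ v, v ∉ Set.range a → ∀ w, (N * P) v w = (1 : Matrix V V R) v w := fun v hv w => by
    rw [← h, Matrix.mul_apply, Matrix.mul_apply, hN' v hv]
  -- The rows of `N * P` outside the range of `a` are rows of the identity, so the determinant
  -- reduces to the block on the range, which is the wanted minor.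
  rw [Matrix.twoBlockTriangular_det (N * P) (fun v => v ∈ Set.range a)]
  · have h3 : (N * P).toSquareBlockProp (fun v => ¬ v ∈ Set.range a) = 1 := by
      ext v w
      rw [Matrix.toSquareBlockProp_def, Matrix.of_apply, h2 v v.2]
      simp [Matrix.one_apply, Subtype.ext_iff]
    let E : ι ≃ {v // v ∈ Set.range a} := Equiv.ofInjective a ha
    have h4 : P.submatrix e a =
        ((N * P).toSquareBlockProp (fun v => v ∈ Set.range a)).submatrix E E := by
      ext k l
      simp [Matrix.toSquareBlockProp_def, h1, E]
    rw [h3, Matrix.det_one, mul_one, h4]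
    convert Matrix.det_submatrix_equiv_self E _
  · intro v hv w hw
    rw [h2 v hv, Matrix.one_apply_ne]
    rintro rfl
    exact hv hw

/-! ### Consecutive elements of a list -/

/-- Paths are handled below through their consecutive pairs. In index form, successors and
predecessors in a list without repetition are visibly unique. -/
theorem pair_infix_iff {V : Type*} {p : List V} {v w : V} :
    [v, w] <:+: p ↔ ∃ n : ℕ, p[n]? = some v ∧ p[n + 1]? = some w := by
  constructor
  · rintro ⟨l, r, rfl⟩
    exact ⟨l.length, by simp, by simp⟩
  · rintro ⟨n, hv, hw⟩
    obtain ⟨hn, rfl⟩ := List.getElem?_eq_some_iff.1 hv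
    obtain ⟨hn', rfl⟩ := List.getElem?_eq_some_iff.1 hw
    refine ⟨p.take n, p.drop (n + 2), ?_⟩
    conv_rhs => rw [← List.take_append_drop n p, List.drop_eq_getElem_cons hn,
      List.drop_eq_getElem_cons hn']
    simp

theorem Nodup.getElem?_inj {V : Type*} {p : List V} (hp : p.Nodup) {m n : ℕ} {v : V}
    (hm : p[m]? = some v) (hn : p[n]? = some v) : m = n := by
  obtain ⟨h1, h1'⟩ := List.getElem?_eq_some_iff.1 hm
  obtain ⟨h2, h2'⟩ := List.getElem?_eq_some_iff.1 hn
  exact (hp.getElem_inj_iff).1 (h1'.trans h2'.symm)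

theorem pair_infix_right_unique {V : Type*} {p : List V} (hp : p.Nodup) {v w w' : V}
    (h : [v, w] <:+: p) (h' : [v, w'] <:+: p) : w = w' := by
  obtain ⟨m, h1, h2⟩ := pair_infix_iff.1 h
  obtain ⟨n, h3, h4⟩ := pair_infix_iff.1 h'
  obtain rfl := Nodup.getElem?_inj hp h1 h3
  exact Option.some.inj (h2.symm.trans h4)

theorem pair_infix_left_unique {V : Type*} {p : List V} (hp : p.Nodup) {v v' w : V}
    (h : [v, w] <:+: p) (h' : [v', w] <:+: p) : v = v' := by
  obtain ⟨m, h1, h2⟩ := pair_infix_iff.1 h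
  obtain ⟨n, h3, h4⟩ := pair_infix_iff.1 h'
  obtain rfl : m = n := Nat.succ_injective (Nodup.getElem?_inj hp h2 h4)
  exact Option.some.inj (h1.symm.trans h3)

theorem head?_ne_of_pair_infix {V : Type*} {p : List V} (hp : p.Nodup) {v w : V}
    (h : [v, w] <:+: p) : p.head? ≠ some w := by
  obtain ⟨m, -, h2⟩ := pair_infix_iff.1 h
  intro hw
  rw [List.head?_eq_getElem?] at hw
  exact absurd (Nodup.getElem?_inj hp hw h2) (by omega)

theorem getLast?_ne_of_pair_infix {V : Type*} {p : List V} (hp : p.Nodup) {v w : V}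
    (h : [v, w] <:+: p) : p.getLast? ≠ some v := by
  obtain ⟨m, h1, h2⟩ := pair_infix_iff.1 h
  intro hw
  rw [List.getLast?_eq_getElem?] at hw
  have := Nodup.getElem?_inj hp h1 hw
  obtain ⟨h3, -⟩ := List.getElem?_eq_some_iff.1 h2
  omega

theorem exists_pair_infix_of_getLast?_ne {V : Type*} {p : List V} {v : V} (hv : v ∈ p)
    (h : p.getLast? ≠ some v) : ∃ w, [v, w] <:+: p := by
  obtain ⟨n, hn⟩ := List.mem_iff_getElem?.1 hv
  rw [List.getLast?_eq_getElem?] at h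
  obtain ⟨h1, -⟩ := List.getElem?_eq_some_iff.1 hn
  have h2 : n ≠ p.length - 1 := by
    rintro rfl
    exact h hn
  exact ⟨p[n + 1], pair_infix_iff.2 ⟨n, hn, List.getElem?_eq_getElem (by omega)⟩⟩

theorem exists_pair_infix_of_head?_ne {V : Type*} {p : List V} {v : V} (hv : v ∈ p)
    (h : p.head? ≠ some v) : ∃ u, [u, v] <:+: p := by
  obtain ⟨n, hn⟩ := List.mem_iff_getElem?.1 hv
  rw [List.head?_eq_getElem?] at h
  obtain ⟨h1, -⟩ := List.getElem?_eq_some_iff.1 hn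
  cases n with
  | zero => exact absurd hn h
  | succ n => exact ⟨p[n], pair_infix_iff.2 ⟨n, List.getElem?_eq_getElem (by omega), hn⟩⟩

/-! ### Directed paths in acyclic graphs -/

theorem IsDAG.nodup_of_isChain {V : Type*} {G : Digraph V} (hG : IsDAG G) {p : List V}
    (hp : p.IsChain G.Adj) : p.Nodup := by
  have h : p.IsChain (Relation.TransGen G.Adj) := hp.imp fun _ _ => Relation.TransGen.single
  refine h.pairwise.imp ?_
  rintro v _ h rfl
  exact hG v h

theorem IsDAG.ne_of_adj {V : Type*} {G : Digraph V} (hG : IsDAG G) {v w : V} (h : G.Adj v w) :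
    v ≠ w := by
  rintro rfl
  exact hG v (.single h)

theorem IsDAG.wellFounded {V : Type*} [Finite V] {G : Digraph V} (hG : IsDAG G) :
    WellFounded G.Adj := by
  have : Std.Irrefl (Relation.TransGen G.Adj) := ⟨hG⟩
  exact WellFounded.mono (Finite.wellFounded_of_trans_of_irrefl (Relation.TransGen G.Adj))
    fun _ _ => Relation.TransGen.single

theorem reflTransGen_of_mem {V : Type*} {R : V → V → Prop} {p : List V} (hp : p.IsChain R)
    {s v : V} (hs : p.head? = some s) (hv : v ∈ p) : Relation.ReflTransGen R s v := by
  induction p generalizing s with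
  | nil => simp at hv
  | cons x p ih =>
    obtain rfl : x = s := by simpa using hs
    rcases List.mem_cons.1 hv with rfl | hv
    · exact .refl
    · cases p with
      | nil => simp at hv
      | cons y p =>
        rw [List.isChain_cons_cons] at hp
        exact .head hp.1 (ih hp.2 rfl hv)

/-! ### Trails of a map -/

/-- One step of the map `f`, away from its fixed points. -/
def Moves {V : Type*} (f : V → V) (x y : V) : Prop :=
  f x = y ∧ x ≠ y

/-- The first at most `n` steps of `f`, starting at `v` and ending at the first fixed point. -/
def iterateList {V : Type*} [DecidableEq V] (f : V → V) : ℕ → V → List V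
  | 0, v => [v]
  | n + 1, v => if f v = v then [v] else v :: iterateList f n (f v)

theorem head?_iterateList {V : Type*} [DecidableEq V] (f : V → V) (n : ℕ) (v : V) :
    (iterateList f n v).head? = some v := by
  cases n with
  | zero => rfl
  | succ n =>
    rw [iterateList]
    split_ifs <;> rfl

theorem isChain_iterateList {V : Type*} [DecidableEq V] (f : V → V) (n : ℕ) (v : V) :
    (iterateList f n v).IsChain (Moves f) := by
  induction n generalizing v with
  | zero => exact .singleton v
  | succ n ih =>
    rw [iterateList]
    split_ifs with h
    · exact .singleton v
    · refine List.IsChain.cons (ih (f v)) fun y hy => ?_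
      rw [head?_iterateList, Option.mem_some_iff] at hy
      exact ⟨hy, fun hvy => h (hy.trans hvy.symm)⟩

/-- The second alternative means that the steps ran out before a fixed point was found. For `trail`
it would give more distinct vertices than `V` has, so acyclicity excludes it. -/
theorem getLast?_iterateList {V : Type*} [DecidableEq V] (f : V → V) (n : ℕ) (v : V) :
    (∃ w, (iterateList f n v).getLast? = some w ∧ f w = w) ∨
      (iterateList f n v).length = n + 1 := by
  induction n generalizing v with
  | zero => exact .inr rfl
  | succ n ih =>
    rw [iterateList]
    split_ifs with h
    · exact .inl ⟨v, rfl, h⟩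
    · rcases ih (f v) with ⟨w, hw, hfw⟩ | hlen
      · exact .inl ⟨w, by rw [List.getLast?_cons, hw]; rfl, hfw⟩
      · exact .inr (by rw [List.length_cons, hlen])

theorem eq_iterateList {V : Type*} [DecidableEq V] {f : V → V} {n : ℕ} {p : List V} {v w : V}
    (hp : p.IsChain (Moves f)) (hv : p.head? = some v) (hw : p.getLast? = some w)
    (hfw : f w = w) (hn : p.length ≤ n + 1) : p = iterateList f n v := by
  induction n generalizing p v with
  | zero =>
    match p with
    | [] => simp at hv
    | [x] => simpa [iterateList] using hv
    | x :: y :: p => simp at hn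
  | succ n ih =>
    match p with
    | [] => simp at hv
    | [x] =>
      simp only [List.head?_cons, Option.some.injEq, List.getLast?_singleton] at hv hw
      subst hv hw
      simp [iterateList, hfw]
    | x :: y :: p =>
      simp only [List.head?_cons, Option.some.injEq] at hv
      subst hv
      rw [List.isChain_cons_cons] at hp
      have h := ih hp.2 rfl (by rwa [List.getLast?_cons_cons] at hw) (by simpa using hn)
      rw [iterateList, if_neg fun h' => hp.1.2 (h'.symm.trans hp.1.1), hp.1.1, ← h]

/-- The vertices visited by the map `f` from `v` until a fixed point is met. -/
def trail {V : Type*} [Fintype V] [DecidableEq V] (f : V → V) (v : V) : List V :=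
  iterateList f (Fintype.card V) v

theorem eq_trail {V : Type*} [Fintype V] [DecidableEq V] {f : V → V} {p : List V} {v w : V}
    (hp : p.IsChain (Moves f)) (hp' : p.Nodup) (hv : p.head? = some v)
    (hw : p.getLast? = some w) (hfw : f w = w) : p = trail f v :=
  eq_iterateList hp hv hw hfw (hp'.length_le_card.trans (Nat.le_succ _))

/-- The map `f` moves vertices along edges of `G`. -/
def AlongEdges {V : Type*} (G : Digraph V) (f : V → V) : Prop :=
  ∀ v, f v = v ∨ G.Adj v (f v)

theorem AlongEdges.adj {V : Type*} {G : Digraph V} {f : V → V} (hf : AlongEdges G f) {v w : V}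
    (h : Moves f v w) : G.Adj v w := by
  obtain ⟨rfl, h⟩ := h
  exact (hf v).resolve_left (Ne.symm h)

theorem AlongEdges.isDirPath_trail {V : Type*} [Fintype V] [DecidableEq V] {G : Digraph V}
    (hG : IsDAG G) {f : V → V} (hf : AlongEdges G f) (v : V) :
    ∃ w, IsDirPath G v w (trail f v) ∧ f w = w := by
  have h1 : (trail f v).IsChain G.Adj := (isChain_iterateList f _ v).imp fun _ _ => hf.adj
  have h2 := hG.nodup_of_isChain h1
  rcases getLast?_iterateList f (Fintype.card V) v with ⟨w, hw, hfw⟩ | h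
  · exact ⟨w, ⟨h1, h2, head?_iterateList f _ v, hw⟩, hfw⟩
  · have := h2.length_le_card
    rw [trail, h] at this
    omega

theorem AlongEdges.mem_trail_iff {V : Type*} [Fintype V] [DecidableEq V] {G : Digraph V}
    (hG : IsDAG G) {f : V → V} (hf : AlongEdges G f) {v w : V} :
    w ∈ trail f v ↔ Relation.ReflTransGen (Moves f) v w := by
  refine ⟨reflTransGen_of_mem (isChain_iterateList f _ v) (head?_iterateList f _ v), fun h => ?_⟩
  obtain ⟨z, ⟨-, hnd, hhead, hlast⟩, hz⟩ := hf.isDirPath_trail hG v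
  induction h with
  | refl => exact List.mem_of_mem_head? hhead
  | @tail x y _ hxy ih =>
    -- The trail ends in a fixed point and `x` is moved, so `x` is not last; its successor on the
    -- trail can only be `f x`.
    obtain ⟨y', hy'⟩ := exists_pair_infix_of_getLast?_ne ih (by
      rw [hlast]
      rintro ⟨⟩
      exact hxy.2 (hz.symm.trans hxy.1))
    have hm := (isChain_iterateList f _ v).infix hy'
    rw [List.isChain_cons_cons] at hm
    rw [← hxy.1, hm.1.1]
    exact hy'.subset (by simp)

/-- `f` moves along edges, fixes `A`, and its trails from `S` are disjoint paths from `S` to `A`. -/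
structure IsLinkage {V : Type*} (G : Digraph V) (S A : Set V) (f : V → V) : Prop where
  along : AlongEdges G f
  fix : ∀ v ∈ A, f v = v
  bij : Set.BijOn f Aᶜ Sᶜ

namespace IsLinkage

variable {V : Type*} {G : Digraph V} {S A : Set V} {f : V → V}

theorem notMem_of_moves (hf : IsLinkage G S A f) {u v : V} (h : Moves f u v) : u ∉ A ∧ v ∉ S := by
  have hu : u ∉ A := fun hu => h.2 ((hf.fix u hu).symm.trans h.1)
  exact ⟨hu, h.1 ▸ hf.bij.mapsTo hu⟩

/-- At a fixed point outside `A`, the last step of the trail would give a second preimage, against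
injectivity off `A`. Without a step, the point of `S` would be an image of `Aᶜ`. -/
theorem mem_of_reach (hf : IsLinkage G S A f) {s v : V} (hs : s ∈ S)
    (h : Relation.ReflTransGen (Moves f) s v) (hv : f v = v) : v ∈ A := by
  by_contra hvA
  rcases Relation.ReflTransGen.cases_tail h with rfl | ⟨u, -, huv⟩
  · exact hf.bij.mapsTo hvA (hv.symm ▸ hs)
  · exact huv.2 (hf.bij.injOn (hf.notMem_of_moves huv).1 hvA (huv.1.trans hv.symm))

/-- Walk both trails backwards: predecessors agree by injectivity, and the walk can only stop in
`S`, which no step enters. -/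
theorem eq_of_reach (hf : IsLinkage G S A f) {s s' v : V} (hs : s ∈ S) (hs' : s' ∈ S)
    (h : Relation.ReflTransGen (Moves f) s v) (h' : Relation.ReflTransGen (Moves f) s' v) :
    s = s' := by
  induction h with
  | refl =>
    rcases Relation.ReflTransGen.cases_tail h' with h | ⟨u, -, hu⟩
    · exact h
    · exact absurd hs (hf.notMem_of_moves hu).2
  | @tail u v _ huv ih =>
    rcases Relation.ReflTransGen.cases_tail h' with rfl | ⟨u', hu', hu'v⟩
    · exact absurd hs' (hf.notMem_of_moves huv).2
    · obtain rfl : u = u' := hf.bij.injOn (hf.notMem_of_moves huv).1 (hf.notMem_of_moves hu'v).1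
        (huv.1.trans hu'v.1.symm)
      exact ih hu'

/-- Walk backwards by surjectivity onto `Sᶜ`. The preimage of a moved vertex is again moved, and
acyclicity forces the walk to stop, which happens only in `S`. -/
theorem exists_reach [Finite V] (hG : IsDAG G) (hf : IsLinkage G S A f) {v : V} (hv : f v ≠ v) :
    ∃ s ∈ S, Relation.ReflTransGen (Moves f) s v := by
  induction v using hG.wellFounded.induction with
  | _ v ih =>
    by_cases hvS : v ∈ S
    · exact ⟨v, hvS, .refl⟩
    · obtain ⟨u, -, rfl⟩ := hf.bij.surjOn hvS
      have huv : u ≠ f u := fun h => hv (congrArg f h.symm)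
      obtain ⟨s, hs, hsu⟩ := ih u (hf.along.adj ⟨rfl, huv⟩) huv.symm
      exact ⟨s, hs, hsu.tail ⟨rfl, huv⟩⟩

theorem exists_reach_of_mem [Finite V] (hG : IsDAG G) (hf : IsLinkage G S A f) {v : V}
    (hv : v ∈ A) : ∃ s ∈ S, Relation.ReflTransGen (Moves f) s v := by
  by_cases hvS : v ∈ S
  · exact ⟨v, hvS, .refl⟩
  · obtain ⟨u, hu, rfl⟩ := hf.bij.surjOn hvS
    have huv : u ≠ f u := fun h => hu (h ▸ hv)
    obtain ⟨s, hs, hsu⟩ := hf.exists_reach hG huv.symm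
    exact ⟨s, hs, hsu.tail ⟨rfl, huv⟩⟩

theorem disjoint_trail [Fintype V] [DecidableEq V] (hG : IsDAG G) (hf : IsLinkage G S A f)
    {s s' : V} (hs : s ∈ S) (hs' : s' ∈ S) (h : s ≠ s') :
    List.Disjoint (trail f s) (trail f s') := fun _ h1 h2 =>
  h (hf.eq_of_reach hs hs' ((hf.along.mem_trail_iff hG).1 h1) ((hf.along.mem_trail_iff hG).1 h2))

end IsLinkage

/-- A family of disjoint directed paths from `S` to `A` consists of the trails of a map. -/
theorem exists_isLinkage {V : Type*} [Fintype V] [DecidableEq V] {G : Digraph V} (hG : IsDAG G)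
    {S A : Set V} {p : V → List V} {q : V → V} (hp : ∀ s ∈ S, IsDirPath G s (q s) (p s))
    (hd : ∀ s ∈ S, ∀ s' ∈ S, s ≠ s' → List.Disjoint (p s) (p s')) (hq : q '' S = A) :
    ∃ f, IsLinkage G S A f ∧ ∀ s ∈ S, p s = trail f s := by
  classical
  have hsame : ∀ s ∈ S, ∀ s' ∈ S, ∀ v, v ∈ p s → v ∈ p s' → s = s' := fun s hs s' hs' v h h' => by
    by_contra hne
    exact hd s hs s' hs' hne h h'
  -- The successor of `v` on the path through it. Ends of paths and vertices off all paths are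
  -- fixed.
  let f : V → V := fun v => if h : ∃ w, ∃ s ∈ S, [v, w] <:+: p s then h.choose else v
  have hf1 : ∀ s ∈ S, ∀ v w, [v, w] <:+: p s → f v = w := fun s hs v w h => by
    have hex : ∃ w, ∃ s ∈ S, [v, w] <:+: p s := ⟨w, s, hs, h⟩
    obtain ⟨s', hs', h'⟩ := hex.choose_spec
    have hfv : f v = hex.choose := dif_pos hex
    rw [← hfv] at h'
    obtain rfl := hsame s hs s' hs' v (h.subset (by simp)) (h'.subset (by simp))
    exact pair_infix_right_unique (hp s hs).2.1 h' h
  have hf2 : ∀ v, f v = v ∨ ∃ s ∈ S, [v, f v] <:+: p s := fun v => by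
    by_cases hex : ∃ w, ∃ s ∈ S, [v, w] <:+: p s
    · have hfv : f v = hex.choose := dif_pos hex
      exact .inr (hfv ▸ hex.choose_spec)
    · exact .inl (dif_neg hex)
  have hadj : ∀ s ∈ S, ∀ v w, [v, w] <:+: p s → G.Adj v w := fun s hs v w h => by
    have := (hp s hs).1.infix h
    rw [List.isChain_cons_cons] at this
    exact this.1
  have hmemq : ∀ s ∈ S, q s ∈ p s := fun s hs => List.mem_of_mem_getLast? (hp s hs).2.2.2
  have hmems : ∀ s ∈ S, s ∈ p s := fun s hs => List.mem_of_mem_head? (hp s hs).2.2.1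
  have hnotA : ∀ s ∈ S, ∀ v w, [v, w] <:+: p s → v ∉ A := fun s hs v w h hv => by
    obtain ⟨s', hs', rfl⟩ := hq.symm ▸ hv
    obtain rfl := hsame s hs s' hs' _ (h.subset (by simp)) (hmemq s' hs')
    exact getLast?_ne_of_pair_infix (hp s hs).2.1 h (hp s hs).2.2.2
  have hnotS : ∀ s ∈ S, ∀ v w, [v, w] <:+: p s → w ∉ S := fun s hs v w h hw => by
    obtain rfl := hsame s hs w hw _ (h.subset (by simp)) (hmems w hw)
    exact head?_ne_of_pair_infix (hp s hs).2.1 h (hp s hs).2.2.1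
  have hfix : ∀ v ∈ A, f v = v := fun v hv => by
    rcases hf2 v with h | ⟨s, hs, h⟩
    · exact h
    · exact absurd hv (hnotA s hs _ _ h)
  have hnext : ∀ s ∈ S, ∀ v ∈ p s, v ∉ A → [v, f v] <:+: p s := fun s hs v hv hvA => by
    obtain ⟨w, hw⟩ := exists_pair_infix_of_getLast?_ne hv (by
      rw [(hp s hs).2.2.2]
      rintro ⟨⟩
      exact hvA (hq ▸ Set.mem_image_of_mem q hs))
    rwa [hf1 s hs v w hw]
  refine ⟨f, ⟨fun v => ?_, hfix, ?_, ?_, ?_⟩, fun s hs => ?_⟩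
  · rcases hf2 v with h | ⟨s, hs, h⟩
    · exact .inl h
    · exact .inr (hadj s hs _ _ h)
  · intro v hv hfv
    rcases hf2 v with h | ⟨s, hs, h⟩
    · rw [h] at hfv
      exact hG.ne_of_adj (hadj v hfv _ _ (hnext v hfv v (hmems v hfv) hv)) h.symm
    · exact hnotS s hs _ _ h hfv
  -- If `u` moved to a fixed `v` outside `A`, then `v` would be an inner vertex of a path and would
  -- move on.
  · have key : ∀ u v, u ∉ A → v ∉ A → f u = f v → f v = v → u = v := fun u v hu hv h hv' => by
      rcases hf2 u with h1 | ⟨s, hs, h1⟩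
      · exact h1.symm.trans (h.trans hv')
      · have h2 := hnext s hs (f u) (h1.subset (by simp)) (by rwa [h, hv'])
        refine absurd ?_ (hG.ne_of_adj (hadj s hs _ _ h2))
        rw [h, hv', hv']
    intro u hu v hv h
    rcases hf2 v with h1 | ⟨s, hs, h1⟩
    · exact key u v hu hv h h1
    · rcases hf2 u with h2 | ⟨s', hs', h2⟩
      · exact (key v u hv hu h.symm h2).symm
      · rw [h] at h2
        obtain rfl := hsame s hs s' hs' (f v) (h1.subset (by simp)) (h2.subset (by simp))
        exact pair_infix_left_unique (hp s hs).2.1 h2 h1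
  · intro v hv
    by_cases hex : ∃ s ∈ S, v ∈ p s
    · obtain ⟨s, hs, hvs⟩ := hex
      obtain ⟨u, hu⟩ := exists_pair_infix_of_head?_ne hvs (by
        rw [(hp s hs).2.2.1]
        rintro ⟨⟩
        exact hv hs)
      exact ⟨u, hnotA s hs _ _ hu, hf1 s hs _ _ hu⟩
    · refine ⟨v, fun hvA => ?_, (hf2 v).resolve_right fun ⟨s, hs, h⟩ =>
        hex ⟨s, hs, h.subset (by simp)⟩⟩
      obtain ⟨s, hs, rfl⟩ := hq.symm ▸ hvA
      exact hex ⟨s, hs, hmemq s hs⟩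
  · refine eq_trail ?_ (hp s hs).2.1 (hp s hs).2.2.1 (hp s hs).2.2.2
      (hfix _ (hq ▸ Set.mem_image_of_mem q hs))
    exact (List.isChain_isInfix (p s)).imp fun v w h =>
      ⟨hf1 s hs v w h, hG.ne_of_adj (hadj s hs v w h)⟩

/-! ### Monomials of linkages -/

/-- The exponent of the product of the `λ_{v, f v}` over the vertices `v` moved by `f`. -/
noncomputable def edgeExponent {V : Type*} [Fintype V] (G : Digraph V) (f : V → V) :
    Param G →₀ ℕ :=
  open Classical in
  ∑ v, if h : G.Adj v (f v) then Finsupp.single (Param.lambda v (f v) h) 1 else 0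

theorem edgeExponent_lambda {V : Type*} [Fintype V] {G : Digraph V} (f : V → V) {v w : V}
    (h : G.Adj v w) : edgeExponent G f (Param.lambda v w h) ≠ 0 ↔ f v = w := by
  classical
  rw [edgeExponent, Finsupp.finsetSum_apply, Ne, Finset.sum_eq_zero_iff]
  constructor
  · intro hne
    push Not at hne
    obtain ⟨u, -, hu⟩ := hne
    split_ifs at hu with h'
    · by_contra hfw
      refine hu (Finsupp.single_eq_of_ne fun heq => hfw ?_)
      injection heq with h1 h2
      subst h1
      exact h2.symm
    · simp at hu
  · rintro rfl h0
    have := h0 v (Finset.mem_univ v)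
    rw [dif_pos h, Finsupp.single_eq_same] at this
    exact one_ne_zero this

theorem edgeExponent_omega {V : Type*} [Fintype V] {G : Digraph V} (f : V → V) (v : V) :
    edgeExponent G f (Param.omega v) = 0 := by
  classical
  rw [edgeExponent, Finsupp.finsetSum_apply]
  refine Finset.sum_eq_zero fun u _ => ?_
  split_ifs with h
  · exact Finsupp.single_eq_of_ne (by simp)
  · rfl

/-- The variables that occur list all moves of the map, and a vertex without such a variable is
fixed. This is what rules out cancellation. -/
theorem AlongEdges.edgeExponent_inj {V : Type*} [Fintype V] {G : Digraph V} {f g : V → V}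
    (hf : AlongEdges G f) (hg : AlongEdges G g) (h : edgeExponent G f = edgeExponent G g) :
    f = g := by
  funext v
  rcases hf v with h1 | h1
  · rcases hg v with h2 | h2
    · rw [h1, h2]
    · rw [← edgeExponent_lambda f h2, h, edgeExponent_lambda]
  · exact ((edgeExponent_lambda g h1).1 (h ▸ (edgeExponent_lambda f h1).2 rfl)).symm

/-- The weight `λ_{v, f v}` of the step of `f` at `v`, or `1` if `f` fixes `v`. -/
noncomputable def stepWeight {V : Type*} (G : Digraph V) (f : V → V) (v : V) :
    MvPolynomial (Param G) ℝ :=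
  open Classical in
  if f v = v then 1 else edgeWeight G v (f v)

theorem AlongEdges.prod_stepWeight {V : Type*} [Fintype V] {G : Digraph V} (hG : IsDAG G)
    {f : V → V} (hf : AlongEdges G f) :
    ∏ v, stepWeight G f v = MvPolynomial.monomial (edgeExponent G f) 1 := by
  classical
  rw [edgeExponent, MvPolynomial.monomial_sum_one]
  refine Finset.prod_congr rfl fun v _ => ?_
  rcases hf v with h | h
  · rw [stepWeight, if_pos h, dif_neg]
    · rfl
    · rw [h]
      exact fun h' => hG.ne_of_adj h' rfl
  · rw [stepWeight, if_neg (hG.ne_of_adj h).symm, dif_pos h, edgeWeight, dif_pos h]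
    rfl

theorem pathMonomial_cons_cons {V : Type*} (G : Digraph V) (x y : V) (p : List V) :
    pathMonomial G (x :: y :: p) = edgeWeight G x y * pathMonomial G (y :: p) := rfl

theorem pathMonomial_eq_prod {V : Type*} [DecidableEq V] (G : Digraph V) {f : V → V} {p : List V}
    {w : V} (hp : p.IsChain (Moves f)) (hnd : p.Nodup) (hw : p.getLast? = some w)
    (hfw : f w = w) : pathMonomial G p = ∏ v ∈ p.toFinset, stepWeight G f v := by
  rw [List.prod_toFinset _ hnd]
  clear hnd
  induction p with
  | nil => simp at hw
  | cons x p ih =>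
    cases p with
    | nil =>
      obtain rfl : x = w := by simpa using hw
      simp [pathMonomial, stepWeight, hfw]
    | cons y p =>
      rw [List.isChain_cons_cons] at hp
      rw [pathMonomial_cons_cons, ih hp.2 (by rwa [List.getLast?_cons_cons] at hw),
        List.map_cons (a := x), List.prod_cons (a := stepWeight G f x), stepWeight.eq_1 G f x,
        if_neg fun h : f x = x => hp.1.2 (h.symm.trans hp.1.1), hp.1.1]

/-- The trails from `S` are disjoint and cover every moved vertex, so the product over paths is the
product over all vertices. -/
theorem IsLinkage.prod_pathMonomial {V : Type*} [Fintype V] [DecidableEq V] {G : Digraph V}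
    (hG : IsDAG G) {S : Finset V} {A : Set V} {f : V → V} (hf : IsLinkage G S A f) :
    ∏ s ∈ S, pathMonomial G (trail f s) = MvPolynomial.monomial (edgeExponent G f) 1 := by
  rw [← hf.along.prod_stepWeight hG]
  have h1 : ∀ s ∈ S, pathMonomial G (trail f s) = ∏ v ∈ (trail f s).toFinset, stepWeight G f v := by
    intro s _
    obtain ⟨w, hw, hfw⟩ := hf.along.isDirPath_trail hG s
    exact pathMonomial_eq_prod G (isChain_iterateList f _ s) hw.2.1 hw.2.2.2 hfw
  rw [Finset.prod_congr rfl h1, ← Finset.prod_biUnion]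
  · refine Finset.prod_subset (Finset.subset_univ _) fun v _ hv => ?_
    rw [stepWeight, if_pos]
    by_contra hfv
    obtain ⟨s, hs, hsv⟩ := hf.exists_reach hG hfv
    exact hv (Finset.mem_biUnion.2 ⟨s, hs, List.mem_toFinset.2 ((hf.along.mem_trail_iff hG).2 hsv)⟩)
  · intro s hs s' hs' hne
    rw [Function.onFun, Finset.disjoint_left]
    intro v h h'
    exact hf.disjoint_trail hG hs hs' hne (List.mem_toFinset.1 h) (List.mem_toFinset.1 h')

/-! ### Trek systems and pairs of linkages -/

/-- The treks of `𝒯` start at the elements of `S`, follow `f` to the left and `g` to the right. -/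
structure Encodes {V : Type*} [Fintype V] [DecidableEq V] {G : Digraph V} (𝒯 : Finset (Trek G))
    (S : Finset V) (f g : V → V) : Prop where
  injOn : Set.InjOn Trek.top (𝒯 : Set (Trek G))
  image : 𝒯.image Trek.top = S
  left : ∀ T ∈ 𝒯, T.left = trail f T.top
  right : ∀ T ∈ 𝒯, T.right = trail g T.top

theorem Trek.ext_of_paths {V : Type*} {G : Digraph V} {T T' : Trek G} (h : T.top = T'.top)
    (hl : T.left = T'.left) (hr : T.right = T'.right) : T = T' := by
  refine Trek.ext h ?_ ?_ hl hr
  · exact Option.some.inj (T.left_path.2.2.2.symm.trans (hl ▸ T'.left_path.2.2.2))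
  · exact Option.some.inj (T.right_path.2.2.2.symm.trans (hr ▸ T'.right_path.2.2.2))

theorem Trek.top_mem_left {V : Type*} {G : Digraph V} (T : Trek G) : T.top ∈ T.left :=
  List.mem_of_mem_head? T.left_path.2.2.1

namespace Encodes

variable {V : Type*} [Fintype V] [DecidableEq V] {G : Digraph V} {𝒯 𝒯' : Finset (Trek G)}
  {S : Finset V} {A B : Set V} {f g f' g' : V → V}

theorem top_mem (h : Encodes 𝒯 S f g) {T : Trek G} (hT : T ∈ 𝒯) : T.top ∈ S :=
  h.image ▸ Finset.mem_image_of_mem _ hT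

theorem exists_top (h : Encodes 𝒯 S f g) {s : V} (hs : s ∈ S) : ∃ T ∈ 𝒯, T.top = s :=
  Finset.mem_image.1 (h.image ▸ hs)

theorem card_eq (h : Encodes 𝒯 S f g) : 𝒯.card = S.card := by
  rw [← h.image, Finset.card_image_of_injOn h.injOn]

theorem subset_of_encodes (h : Encodes 𝒯 S f g) (h' : Encodes 𝒯' S f g) : 𝒯 ⊆ 𝒯' := by
  intro T hT
  obtain ⟨T', hT', htop⟩ := h'.exists_top (h.top_mem hT)
  have : T = T' := Trek.ext_of_paths htop.symm (by rw [h.left T hT, h'.left T' hT', htop])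
    (by rw [h.right T hT, h'.right T' hT', htop])
  rwa [this]

theorem unique (h : Encodes 𝒯 S f g) (h' : Encodes 𝒯' S f g) : 𝒯 = 𝒯' :=
  Finset.Subset.antisymm (h.subset_of_encodes h') (h'.subset_of_encodes h)

theorem prod_left (hG : IsDAG G) (h : Encodes 𝒯 S f g) (hf : IsLinkage G S A f) :
    ∏ T ∈ 𝒯, pathMonomial G T.left = MvPolynomial.monomial (edgeExponent G f) 1 := by
  rw [← hf.prod_pathMonomial hG, ← h.image, Finset.prod_image h.injOn]
  exact Finset.prod_congr rfl fun T hT => by rw [h.left T hT]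

theorem prod_right (hG : IsDAG G) (h : Encodes 𝒯 S f g) (hg : IsLinkage G S B g) :
    ∏ T ∈ 𝒯, pathMonomial G T.right = MvPolynomial.monomial (edgeExponent G g) 1 := by
  rw [← hg.prod_pathMonomial hG, ← h.image, Finset.prod_image h.injOn]
  exact Finset.prod_congr rfl fun T hT => by rw [h.right T hT]

/-- The system determines the monomial of its left parts, which determines the linkage. -/
theorem left_unique (hG : IsDAG G) (h : Encodes 𝒯 S f g) (h' : Encodes 𝒯 S f' g')
    (hf : IsLinkage G S A f) (hf' : IsLinkage G S A f') : f = f' := by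
  have := (h.prod_left hG hf).symm.trans (h'.prod_left hG hf')
  exact hf.along.edgeExponent_inj hf'.along (MvPolynomial.monomial_left_injective one_ne_zero this)

theorem right_unique (hG : IsDAG G) (h : Encodes 𝒯 S f g) (h' : Encodes 𝒯 S f' g')
    (hg : IsLinkage G S B g) (hg' : IsLinkage G S B g') : g = g' := by
  have := (h.prod_right hG hg).symm.trans (h'.prod_right hG hg')
  exact hg.along.edgeExponent_inj hg'.along (MvPolynomial.monomial_left_injective one_ne_zero this)

theorem trekSystemWeight_eq (hG : IsDAG G) (h : Encodes 𝒯 S f g) (hf : IsLinkage G S A f)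
    (hg : IsLinkage G S B g) : trekSystemWeight 𝒯 = MvPolynomial.monomial
      ((∑ s ∈ S, Finsupp.single (Param.omega s) 1) + edgeExponent G f + edgeExponent G g) 1 := by
  have h1 : trekSystemWeight 𝒯 = (∏ T ∈ 𝒯, MvPolynomial.X (Param.omega T.top)) *
      (∏ T ∈ 𝒯, pathMonomial G T.left) * ∏ T ∈ 𝒯, pathMonomial G T.right := by
    simp only [trekSystemWeight, Trek.weight, Finset.prod_mul_distrib]
  have h2 : ∏ T ∈ 𝒯, (MvPolynomial.X (Param.omega T.top) : MvPolynomial (Param G) ℝ) =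
      MvPolynomial.monomial (∑ s ∈ S, Finsupp.single (Param.omega s) 1) 1 := by
    rw [MvPolynomial.monomial_sum_one, ← h.image, Finset.prod_image h.injOn]
    rfl
  rw [h1, h2, h.prod_left hG hf, h.prod_right hG hg, MvPolynomial.monomial_mul,
    MvPolynomial.monomial_mul, one_mul, one_mul]

theorem noSidedIntersection (hG : IsDAG G) (h : Encodes 𝒯 S f g) (hf : IsLinkage G S A f)
    (hg : IsLinkage G S B g) : NoSidedIntersection 𝒯 := by
  intro T hT T' hT' hne
  have htop : T.top ≠ T'.top := fun he => hne (h.injOn hT hT' he)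
  rw [h.left T hT, h.left T' hT', h.right T hT, h.right T' hT']
  exact ⟨hf.disjoint_trail hG (h.top_mem hT) (h.top_mem hT') htop,
    hg.disjoint_trail hG (h.top_mem hT) (h.top_mem hT') htop⟩

end Encodes

/-- Each trail ends in a fixed point, which lies in `A`. Conversely each vertex of `A` is on a trail
and, being fixed, is its end. The index set `I` will be the trek system, with `q` the left or the
right end. -/
theorem IsLinkage.image_endpoints {V ι : Type*} [Fintype V] [DecidableEq V] {G : Digraph V}
    (hG : IsDAG G) {S A : Set V} {f : V → V} (hf : IsLinkage G S A f) {I : Set ι} {t q : ι → V}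
    (ht : t '' I = S) (hq : ∀ x ∈ I, IsDirPath G (t x) (q x) (trail f (t x))) : q '' I = A := by
  have hqf : ∀ x ∈ I, f (q x) = q x := fun x hx => by
    obtain ⟨w, hw, hfw⟩ := hf.along.isDirPath_trail hG (t x)
    obtain rfl : q x = w := Option.some.inj ((hq x hx).2.2.2.symm.trans hw.2.2.2)
    exact hfw
  have hreach : ∀ x ∈ I, Relation.ReflTransGen (Moves f) (t x) (q x) := fun x hx =>
    (hf.along.mem_trail_iff hG).1 (List.mem_of_mem_getLast? (hq x hx).2.2.2)
  ext v
  constructor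
  · rintro ⟨x, hx, rfl⟩
    exact hf.mem_of_reach (ht ▸ Set.mem_image_of_mem t hx) (hreach x hx) (hqf x hx)
  · intro hv
    obtain ⟨s, hs, hsv⟩ := hf.exists_reach_of_mem hG hv
    obtain ⟨x, hx, rfl⟩ := ht.symm ▸ hs
    refine ⟨x, hx, ?_⟩
    by_contra hne
    obtain ⟨w, hw⟩ := exists_pair_infix_of_getLast?_ne ((hf.along.mem_trail_iff hG).2 hsv) (by
      rw [(hq x hx).2.2.2]
      rintro ⟨⟩
      exact hne rfl)
    have hm := (isChain_iterateList f _ (t x)).infix hw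
    rw [List.isChain_cons_cons] at hm
    exact hm.1.2 ((hf.fix v hv).symm.trans hm.1.1)

theorem Encodes.isTrekSystem {V : Type*} [Fintype V] [DecidableEq V] {G : Digraph V}
    (hG : IsDAG G) {𝒯 : Finset (Trek G)} {S A B : Finset V} {f g : V → V} (h : Encodes 𝒯 S f g)
    (hf : IsLinkage G S A f) (hg : IsLinkage G S B g) (hA : S.card = A.card)
    (hB : S.card = B.card) : IsTrekSystem A B 𝒯 := by
  have himage : Trek.top '' (𝒯 : Set (Trek G)) = S := by rw [← h.image, Finset.coe_image]
  exact ⟨h.card_eq.trans hA, h.card_eq.trans hB,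
    hf.image_endpoints hG himage fun T hT => h.left T hT ▸ T.left_path,
    hg.image_endpoints hG himage fun T hT => h.right T hT ▸ T.right_path⟩

theorem exists_encodes {V : Type*} [Fintype V] [DecidableEq V] {G : Digraph V} (hG : IsDAG G)
    (S : Finset V) {f g : V → V} (hf : AlongEdges G f) (hg : AlongEdges G g) :
    ∃ 𝒯 : Finset (Trek G), Encodes 𝒯 S f g := by
  classical
  choose l hl _ using hf.isDirPath_trail hG
  choose r hr _ using hg.isDirPath_trail hG
  let T : V → Trek G := fun s => ⟨s, l s, r s, trail f s, trail g s, hl s, hr s⟩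
  refine ⟨S.image T, ?_, ?_, ?_, ?_⟩
  · intro x hx y hy hxy
    obtain ⟨s, -, rfl⟩ := Finset.mem_image.1 hx
    obtain ⟨s', -, rfl⟩ := Finset.mem_image.1 hy
    exact congrArg T hxy
  · rw [Finset.image_image]
    exact Finset.image_id
  · intro x hx
    obtain ⟨s, -, rfl⟩ := Finset.mem_image.1 hx
    rfl
  · intro x hx
    obtain ⟨s, -, rfl⟩ := Finset.mem_image.1 hx
    rfl

theorem exists_encoding {V : Type*} [Fintype V] [DecidableEq V] {G : Digraph V} (hG : IsDAG G)
    {𝒯 : Finset (Trek G)} {A B : Finset V} (h : IsTrekSystem A B 𝒯)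
    (hd : NoSidedIntersection 𝒯) :
    ∃ (S : Finset V) (f g : V → V), S.card = A.card ∧ IsLinkage G S A f ∧ IsLinkage G S B g ∧
      Encodes 𝒯 S f g := by
  classical
  -- The top of a trek lies on its left part, so disjoint left parts have distinct tops.
  have hinj : Set.InjOn Trek.top (𝒯 : Set (Trek G)) := fun T hT T' hT' htop => by
    by_contra hne
    exact (hd T hT T' hT' hne).1 T.top_mem_left (htop ▸ T'.top_mem_left)
  have hsurj : ∀ s ∈ 𝒯.image Trek.top, ∃ T ∈ 𝒯, T.top = s := fun s hs => Finset.mem_image.1 hs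
  -- A partial inverse of `Trek.top`; the value `none` at vertices that are not tops is never used.
  have hinv : ∃ t : V → Option (Trek G), ∀ T ∈ 𝒯, t T.top = some T := by
    refine ⟨fun s => if hs : s ∈ 𝒯.image Trek.top then some (hsurj s hs).choose else none, ?_⟩
    intro T hT
    have hs : T.top ∈ 𝒯.image Trek.top := Finset.mem_image_of_mem _ hT
    exact (dif_pos hs).trans <| congrArg some
      (hinj (hsurj _ hs).choose_spec.1 hT (hsurj _ hs).choose_spec.2)
  obtain ⟨t, ht⟩ := hinv
  have main : ∀ (q : Trek G → V) (p : Trek G → List V) (C : Finset V),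
      (∀ T, IsDirPath G T.top (q T) (p T)) →
      (∀ T ∈ 𝒯, ∀ T' ∈ 𝒯, T ≠ T' → List.Disjoint (p T) (p T')) →
      q '' (𝒯 : Set (Trek G)) = C →
      ∃ f, IsLinkage G (𝒯.image Trek.top : Finset V) C f ∧ ∀ T ∈ 𝒯, p T = trail f T.top := by
    intro q p C hp hpd hq
    have hpath : ∀ s ∈ ((𝒯.image Trek.top : Finset V) : Set V),
        IsDirPath G s ((t s).elim s q) ((t s).elim [] p) := by
      intro s hs
      obtain ⟨T, hT, rfl⟩ := hsurj s hs
      simp only [ht T hT]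
      exact hp T
    have hdisj : ∀ s ∈ ((𝒯.image Trek.top : Finset V) : Set V),
        ∀ s' ∈ ((𝒯.image Trek.top : Finset V) : Set V), s ≠ s' →
        List.Disjoint ((t s).elim [] p) ((t s').elim [] p) := by
      intro s hs s' hs' hne
      obtain ⟨T, hT, rfl⟩ := hsurj s hs
      obtain ⟨T', hT', rfl⟩ := hsurj s' hs'
      simp only [ht T hT, ht T' hT']
      exact hpd T hT T' hT' fun h => hne (congrArg _ h)
    have himage : (fun s => (t s).elim s q) '' ((𝒯.image Trek.top : Finset V) : Set V) = C := by
      rw [← hq, Finset.coe_image, Set.image_image]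
      exact Set.image_congr fun T hT => by rw [ht T hT]; rfl
    obtain ⟨f, hf, hpf⟩ := exists_isLinkage hG hpath hdisj himage
    refine ⟨f, hf, fun T hT => ?_⟩
    have := hpf T.top (Finset.mem_image_of_mem _ hT)
    rwa [ht T hT] at this
  obtain ⟨f, hf, hl⟩ := main Trek.leftmost Trek.left A (fun T => T.left_path)
    (fun T hT T' hT' hne => (hd T hT T' hT' hne).1) h.2.2.1
  obtain ⟨g, hg, hr⟩ := main Trek.rightmost Trek.right B (fun T => T.right_path)
    (fun T hT T' hT' hne => (hd T hT T' hT' hne).2) h.2.2.2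
  exact ⟨𝒯.image Trek.top, f, g, by rw [Finset.card_image_of_injOn hinj, h.1], hf, hg,
    hinj, rfl, hl, hr⟩

/-! ### Path sums -/

open Classical in
/-- The directed paths from `u` to `v`. -/
noncomputable def dirPaths {V : Type*} [Fintype V] (G : Digraph V) (u v : V) : Finset (List V) :=
  (Finset.univ.image (Subtype.val : {p : List V // p.Nodup} → List V)).filter (IsDirPath G u v)

theorem mem_dirPaths {V : Type*} [Fintype V] {G : Digraph V} {u v : V} {p : List V} :
    p ∈ dirPaths G u v ↔ IsDirPath G u v p := by
  classical
  simp only [dirPaths, Finset.mem_filter, Finset.mem_image, Finset.mem_univ, true_and,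
    Subtype.exists, exists_prop, exists_eq_right, and_iff_right_iff_imp]
  exact fun h => h.2.1

/-- The matrix whose entries are the sums of the monomials of the directed paths. -/
noncomputable def pathSum {V : Type*} [Fintype V] (G : Digraph V) :
    Matrix V V (MvPolynomial (Param G) ℝ) :=
  Matrix.of fun u v => ∑ p ∈ dirPaths G u v, pathMonomial G p

theorem IsDirPath.cons {V : Type*} {G : Digraph V} (hG : IsDAG G) {u t v : V} {p : List V}
    (hut : G.Adj u t) (hp : IsDirPath G t v p) : IsDirPath G u v (u :: p) := by
  have hc : (u :: p).IsChain G.Adj := hp.1.cons fun y hy => by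
    rw [hp.2.2.1, Option.mem_some_iff] at hy
    exact hy ▸ hut
  exact ⟨hc, hG.nodup_of_isChain hc, rfl, by rw [List.getLast?_cons, hp.2.2.2]; rfl⟩

theorem IsDirPath.eq_or_exists_cons {V : Type*} {G : Digraph V} {u v : V} {p : List V}
    (hp : IsDirPath G u v p) :
    p = [u] ∧ u = v ∨ ∃ t q, p = u :: q ∧ G.Adj u t ∧ IsDirPath G t v q := by
  obtain ⟨hc, hn, hh, hl⟩ := hp
  match p with
  | [] => simp at hh
  | [x] =>
    simp only [List.head?_cons, Option.some.injEq, List.getLast?_singleton] at hh hl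
    exact .inl ⟨by rw [hh], hh.symm.trans hl⟩
  | x :: y :: q =>
    simp only [List.head?_cons, Option.some.injEq] at hh
    subst hh
    rw [List.isChain_cons_cons] at hc
    exact .inr ⟨y, y :: q, rfl, hc.1, hc.2, hn.tail, rfl, by rwa [List.getLast?_cons_cons] at hl⟩

theorem isDirPath_self {V : Type*} (G : Digraph V) (u : V) : IsDirPath G u u [u] :=
  ⟨.singleton u, List.nodup_singleton u, rfl, rfl⟩

theorem pathMonomial_cons {V : Type*} {G : Digraph V} {u t v : V} {p : List V}
    (hp : IsDirPath G t v p) : pathMonomial G (u :: p) = edgeWeight G u t * pathMonomial G p := by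
  obtain ⟨-, -, hh, -⟩ := hp
  match p with
  | [] => simp at hh
  | x :: q =>
    obtain rfl : x = t := by simpa using hh
    rfl

/-- A path without edges contributes the identity matrix; any other path splits off its first edge.
By acyclicity, putting a vertex in front of a path never repeats a vertex. -/
theorem pathSum_eq {V : Type*} [Fintype V] [DecidableEq V] {G : Digraph V} (hG : IsDAG G)
    (u v : V) : pathSum G u v = (if u = v then 1 else 0) +
      ∑ t, edgeWeight G u t * pathSum G t v := by
  classical
  have h1 : ∑ t, edgeWeight G u t * pathSum G t v = ∑ x ∈ (Finset.univ.filter (G.Adj u)).sigma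
      (fun t => dirPaths G t v), pathMonomial G (u :: x.2) := by
    rw [Finset.sum_sigma, Finset.sum_filter]
    refine Finset.sum_congr rfl fun t _ => ?_
    split_ifs with h
    · rw [pathSum, Matrix.of_apply, Finset.mul_sum]
      exact Finset.sum_congr rfl fun p hp => (pathMonomial_cons (mem_dirPaths.1 hp)).symm
    · rw [edgeWeight, dif_neg h, zero_mul]
  have h2 : ∑ x ∈ (Finset.univ.filter (G.Adj u)).sigma (fun t => dirPaths G t v),
      pathMonomial G (u :: x.2) = ∑ p ∈ (dirPaths G u v).erase [u], pathMonomial G p := by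
    refine Finset.sum_bij (fun x _ => u :: x.2) ?_ ?_ ?_ fun _ _ => rfl
    · rintro ⟨t, p⟩ hx
      simp only [Finset.mem_sigma, Finset.mem_filter, Finset.mem_univ, true_and, mem_dirPaths] at hx
      refine Finset.mem_erase.2 ⟨fun h => ?_, mem_dirPaths.2 (hx.2.cons hG hx.1)⟩
      have hp : p = [] := (List.cons.inj h).2
      have := hx.2.2.2.1
      simp [hp] at this
    · rintro ⟨t, p⟩ hx ⟨t', p'⟩ hx' h
      simp only [Finset.mem_sigma, mem_dirPaths] at hx hx'
      obtain rfl : p = p' := (List.cons.inj h).2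
      obtain rfl : t = t' := Option.some.inj (hx.2.2.2.1.symm.trans hx'.2.2.2.1)
      rfl
    · intro p hp
      obtain ⟨hne, hp⟩ := Finset.mem_erase.1 hp
      rcases (mem_dirPaths.1 hp).eq_or_exists_cons with ⟨h, -⟩ | ⟨t, q, rfl, hut, hq⟩
      · exact absurd h hne
      · exact ⟨⟨t, q⟩, by simp [mem_dirPaths, hut, hq], rfl⟩
  rw [h1, h2, pathSum, Matrix.of_apply]
  split_ifs with h
  · subst h
    rw [← Finset.add_sum_erase _ _ (mem_dirPaths.2 (isDirPath_self G u))]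
    rfl
  · rw [zero_add, Finset.erase_eq_of_notMem]
    intro hu
    have := (mem_dirPaths.1 hu).2.2.2
    exact h (by simpa using this)

theorem one_sub_mul_pathSum {V : Type*} [Fintype V] [DecidableEq V] {G : Digraph V}
    (hG : IsDAG G) : (1 - Matrix.of (edgeWeight G)) * pathSum G = 1 := by
  rw [sub_mul, one_mul, sub_eq_iff_eq_add]
  ext1 u v
  rw [pathSum_eq hG, Matrix.add_apply, Matrix.one_apply, Matrix.mul_apply]
  rfl

theorem trekSum_eq {V : Type*} [Fintype V] (G : Digraph V) (u v : V) : trekSum G u v =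
    ∑ s, pathSum G s u * MvPolynomial.X (Param.omega s) * pathSum G s v := by
  have h1 : ∀ s, pathSum G s u * MvPolynomial.X (Param.omega s) * pathSum G s v =
      ∑ x ∈ dirPaths G s u ×ˢ dirPaths G s v,
        MvPolynomial.X (Param.omega s) * pathMonomial G x.1 * pathMonomial G x.2 := by
    intro s
    rw [pathSum, Matrix.of_apply, Matrix.of_apply, mul_comm (Finset.sum _ _), mul_assoc,
      Finset.sum_mul_sum, Finset.mul_sum, Finset.sum_product]
    refine Finset.sum_congr rfl fun p _ => ?_
    rw [Finset.mul_sum]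
    exact Finset.sum_congr rfl fun q _ => (mul_assoc _ _ _).symm
  simp only [h1]
  rw [trekSum, Finset.sum_sigma']
  refine Finset.sum_bij (fun T _ => ⟨T.1.top, T.1.left, T.1.right⟩) ?_ ?_ ?_ fun _ _ => rfl
  · rintro ⟨T, rfl, rfl⟩ -
    simp [mem_dirPaths, T.left_path, T.right_path]
  · rintro ⟨T, hT⟩ - ⟨T', hT'⟩ - h
    simp only [Sigma.mk.injEq, heq_eq_eq, Prod.mk.injEq] at h
    exact Subtype.ext (Trek.ext_of_paths h.1 h.2.1 h.2.2)
  · rintro ⟨s, p, q⟩ h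
    simp only [Finset.mem_sigma, Finset.mem_univ, true_and, Finset.mem_product, mem_dirPaths] at h
    exact ⟨⟨⟨s, u, v, p, q, h.1, h.2⟩, rfl, rfl⟩, Finset.mem_univ _, rfl⟩

theorem phiStar_detSigma {V : Type*} [Fintype V] [DecidableEq V] (G : Digraph V) (i j : V)
    (K : Finset V) : phiStar G (detSigma i j K) =
      (Matrix.of (fun (k : Option K) v =>
        MvPolynomial.X (Param.omega v) * pathSum G v (k.elim i Subtype.val)) *
        (pathSum G).submatrix id fun k : Option K => k.elim j Subtype.val).det := by
  rw [detSigma, AlgHom.map_det]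
  congr 1
  ext1 k l
  rw [Matrix.mul_apply]
  simp only [AlgHom.mapMatrix_apply, Matrix.map_apply, Matrix.submatrix_apply, sigmaMatrix,
    Matrix.of_apply, phiStar, MvPolynomial.aeval_X, Sym2.lift_mk, trekSum_eq, id]
  exact Finset.sum_congr rfl fun s _ => by rw [mul_comm (pathSum G s _)]

/-! ### Minors of the path sum matrix -/

open Classical in
/-- The linkages from `S` to `A`. -/
noncomputable def linkages {V : Type*} [Fintype V] (G : Digraph V) (S A : Finset V) :
    Finset (V → V) :=
  Finset.univ.filter (IsLinkage G S A)

theorem mem_linkages {V : Type*} [Fintype V] {G : Digraph V} {S A : Finset V} {f : V → V} :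
    f ∈ linkages G S A ↔ IsLinkage G S A f := by
  classical
  simp [linkages]

/-- Linkages index the nonzero Leibniz terms of $1-\Lambda$ with the rows in `A` replaced by unit
vectors. The coefficients are signs; only their being nonzero matters later. -/
theorem det_pathSum_submatrix {V ι : Type*} [Fintype V] [DecidableEq V] [Fintype ι]
    [DecidableEq ι] {G : Digraph V} (hG : IsDAG G) {S A : Finset V} {e a : ι → V}
    (he : Function.Injective e) (ha : Function.Injective a) (heS : Finset.univ.image e = S)
    (haA : Finset.univ.image a = A) :
    ∃ c : (V → V) → ℝ, (∀ f, c f ≠ 0) ∧ ((pathSum G).submatrix e a).det =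
      (∑ f ∈ linkages G S A, MvPolynomial.monomial (edgeExponent G f) (c f)) *
        (pathSum G).det := by
  classical
  have hmemS : ∀ v, v ∈ S ↔ ∃ k, e k = v := fun v => by simp [← heS]
  have hmemA : ∀ v, v ∈ A ↔ ∃ k, a k = v := fun v => by simp [← haA]
  have hex : ∃ φ : V → V, ∀ k, φ (a k) = e k :=
    ⟨Function.extend a e id, fun k => ha.extend_apply e id k⟩
  obtain ⟨φ, hφ⟩ := hex
  let M : Matrix V V (MvPolynomial (Param G) ℝ) := 1 - Matrix.of (edgeWeight G)
  let N : Matrix V V (MvPolynomial (Param G) ℝ) :=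
    Matrix.of fun v => if v ∈ A then Pi.single (φ v) 1 else M v
  have hN : ∀ v ∈ A, ∀ w, N v w = if w = φ v then 1 else 0 := fun v hv w => by
    simp only [N, Matrix.of_apply, if_pos hv, Pi.single_apply]
  have hN' : ∀ v, v ∉ A → N v = M v := fun v hv => by
    ext1 w
    simp only [N, Matrix.of_apply, if_neg hv]
  have hdet := det_submatrix_of_mul_eq_one (M := M) (P := pathSum G) (N := N)
    (one_sub_mul_pathSum hG) (e := e) (a := a) ha
    (fun k => by
      ext1 w
      rw [hN _ ((hmemA _).2 ⟨k, rfl⟩), hφ, Pi.single_apply])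
    (fun v hv => hN' v fun h => hv ((hmemA v).1 h))
  have hself : ∀ v, edgeWeight G v v = 0 := fun v => dif_neg fun h => hG.ne_of_adj h rfl
  let ext : (V → V) → V → V := fun f v => if v ∈ A then φ v else f v
  -- On `A` the linkage is redirected to `S` by `φ`, which closes it to a permutation. The default
  -- `1` keeps the coefficient nonzero for maps that are not linkages.
  let perm : (V → V) → Equiv.Perm V := fun f =>
    if h : Function.Bijective (ext f) then Equiv.ofBijective (ext f) h else 1
  have hφA : ∀ v ∈ A, φ v ∈ S := fun v hv => by
    obtain ⟨k, rfl⟩ := (hmemA v).1 hv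
    exact (hmemS _).2 ⟨k, (hφ k).symm⟩
  have hperm : ∀ f, IsLinkage G S A f → ⇑(perm f) = ext f := fun f hf => by
    have hbij : Function.Bijective (ext f) := by
      refine Finite.injective_iff_bijective.1 fun v w h => ?_
      simp only [ext] at h
      split_ifs at h with hv hw hw
      · obtain ⟨k, rfl⟩ := (hmemA v).1 hv
        obtain ⟨l, rfl⟩ := (hmemA w).1 hw
        rw [hφ, hφ] at h
        rw [he h]
      · exact absurd (hφA v hv) (h ▸ hf.bij.mapsTo (by simpa using hw))
      · exact absurd (hφA w hw) (h ▸ hf.bij.mapsTo (by simpa using hv))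
      · exact hf.bij.injOn (by simpa using hv) (by simpa using hw) h
    simp only [perm, dif_pos hbij]
    rfl
  let sgn : (V → V) → ℝ := fun f => ∏ v, if f v = v then 1 else -1
  refine ⟨fun f => (Equiv.Perm.sign (perm f) : ℤ) * sgn f, fun f => ?_, ?_⟩
  · refine mul_ne_zero (by simp) (Finset.prod_ne_zero_iff.2 fun v _ => ?_)
    split_ifs <;> norm_num
  rw [hdet]
  congr 1
  -- After transposing, the factors are `N v (σ v)`, so a permutation selects an entry in each row,
  -- that is, a step out of each vertex.
  rw [← Matrix.det_transpose, Matrix.det_apply']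
  symm
  refine Finset.sum_of_injOn perm ?_ (fun _ _ => Finset.mem_coe.2 (Finset.mem_univ _)) ?_ ?_
  · intro f hf g hg h
    have hf := mem_linkages.1 hf
    have hg := mem_linkages.1 hg
    have h1 : ext f = ext g := by rw [← hperm f hf, ← hperm g hg, h]
    funext v
    by_cases hv : v ∈ A
    · rw [hf.fix v hv, hg.fix v hv]
    · have := congrFun h1 v
      simpa only [ext, if_neg hv] using this
  · intro σ _ hσ
    by_contra hne
    have hprod := Finset.prod_ne_zero_iff.1 (right_ne_zero_of_mul hne)
    simp only [Finset.mem_univ, forall_const, Matrix.transpose_apply] at hprod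
    have hσA : ∀ v ∈ A, σ v = φ v := fun v hv => by
      by_contra h
      exact hprod v (by rw [hN v hv, if_neg h])
    have hσA' : ∀ v, v ∉ A → σ v = v ∨ G.Adj v (σ v) := fun v hv => by
      by_contra! h
      refine hprod v ?_
      rw [hN' v hv]
      simp [M, Matrix.one_apply_ne h.1.symm, edgeWeight, h.2]
    -- A nonzero term forces `σ` to be `φ` on `A` and to follow edges elsewhere; undoing the
    -- redirection on `A` gives the linkage.
    let f : V → V := fun v => if v ∈ A then v else σ v
    have hfA : ∀ v, v ∉ A → f v = σ v := fun v hv => if_neg hv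
    have hf : IsLinkage G S A f := by
      refine ⟨fun v => ?_, fun v hv => if_pos hv, fun v hv hfv => ?_, fun v hv w hw h => ?_,
        fun v hv => ?_⟩
      · by_cases hv : v ∈ A
        · exact .inl (if_pos hv)
        · rw [hfA v hv]
          exact hσA' v hv
      · rw [hfA v hv] at hfv
        obtain ⟨k, hk⟩ := (hmemS _).1 hfv
        have hak : a k ∈ A := (hmemA _).2 ⟨k, rfl⟩
        rw [← hφ, ← hσA _ hak] at hk
        exact hv (σ.injective hk ▸ hak)
      · rw [hfA v hv, hfA w hw] at h
        exact σ.injective h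
      · have hw : σ.symm v ∉ A := fun hw => hv (by
          have := hφA _ hw
          rwa [← hσA _ hw, σ.apply_symm_apply] at this)
        exact ⟨σ.symm v, hw, by rw [hfA _ hw, σ.apply_symm_apply]⟩
    refine hσ ⟨f, mem_linkages.2 hf, ?_⟩
    ext v
    rw [hperm f hf]
    by_cases hv : v ∈ A
    · simp only [ext, if_pos hv, hσA v hv]
    · simp only [ext, if_neg hv, hfA v hv]
  · intro f hf
    have hf := mem_linkages.1 hf
    have hfac : ∀ v, N.transpose (perm f v) v =
        (if f v = v then 1 else -1) * stepWeight G f v := fun v => by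
      rw [hperm f hf, Matrix.transpose_apply]
      by_cases hv : v ∈ A
      · simp [ext, if_pos hv, hN v hv, stepWeight, hf.fix v hv]
      · simp only [ext, if_neg hv, hN' v hv, M, Matrix.sub_apply, Matrix.of_apply, stepWeight]
        split_ifs with h
        · rw [h, hself, Matrix.one_apply_eq, sub_zero, mul_one]
        · rw [Matrix.one_apply_ne (Ne.symm h), zero_sub, neg_mul, one_mul]
    simp only [hfac, Finset.prod_mul_distrib, hf.along.prod_stepWeight hG]
    have hsgn : (∏ v, if f v = v then 1 else -1 : MvPolynomial (Param G) ℝ) =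
        MvPolynomial.C (sgn f) := by
      rw [map_prod]
      refine Finset.prod_congr rfl fun v _ => ?_
      split_ifs <;> simp
    rw [hsgn, ← mul_assoc, ← map_intCast (MvPolynomial.C : ℝ →+* MvPolynomial (Param G) ℝ),
      ← map_mul, MvPolynomial.C_mul_monomial, mul_one]

/-! ### Polynomials with a single term -/

theorem isMonomialTerm_monomial {σ : Type*} (s : σ →₀ ℕ) {c : ℝ} (hc : c ≠ 0) :
    IsMonomialTerm (MvPolynomial.monomial s c) :=
  ⟨s, c, hc, rfl⟩

theorem IsMonomialTerm.ne_zero {σ : Type*} {p : MvPolynomial σ ℝ} (h : IsMonomialTerm p) :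
    p ≠ 0 := by
  obtain ⟨s, c, hc, rfl⟩ := h
  exact fun h0 => hc (MvPolynomial.monomial_eq_zero.1 h0)

theorem IsMonomialTerm.of_dvd {σ : Type*} {p q : MvPolynomial σ ℝ} (h : IsMonomialTerm q)
    (hpq : p ∣ q) : IsMonomialTerm p := by
  have hq := h.ne_zero
  obtain ⟨s, c, hc, rfl⟩ := h
  obtain ⟨m, b, -, -, rfl⟩ := (MvPolynomial.dvd_monomial_iff_exists hc).1 hpq
  refine ⟨m, b, ?_, rfl⟩
  rintro rfl
  rw [MvPolynomial.monomial_zero, zero_dvd_iff] at hpq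
  exact hq hpq

theorem isMonomialTerm_mul {σ : Type*} {p q : MvPolynomial σ ℝ} :
    IsMonomialTerm (p * q) ↔ IsMonomialTerm p ∧ IsMonomialTerm q := by
  refine ⟨fun h => ⟨h.of_dvd (dvd_mul_right p q), h.of_dvd (dvd_mul_left q p)⟩, ?_⟩
  rintro ⟨⟨s, c, hc, rfl⟩, t, d, hd, rfl⟩
  rw [MvPolynomial.monomial_mul]
  exact isMonomialTerm_monomial _ (mul_ne_zero hc hd)

theorem IsUnit.isMonomialTerm {σ : Type*} {p : MvPolynomial σ ℝ} (h : IsUnit p) :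
    IsMonomialTerm p :=
  (isMonomialTerm_monomial 0 one_ne_zero).of_dvd h.dvd

theorem coeff_sum_monomial {σ α : Type*} {s : Finset α} {d : α → σ →₀ ℕ} (c : α → ℝ)
    (hd : Set.InjOn d s) {x : α} (hx : x ∈ s) :
    (∑ y ∈ s, MvPolynomial.monomial (d y) (c y)).coeff (d x) = c x := by
  classical
  rw [MvPolynomial.coeff_sum, Finset.sum_eq_single x, MvPolynomial.coeff_monomial, if_pos rfl]
  · intro y hy hne
    rw [MvPolynomial.coeff_monomial, if_neg fun h => hne (hd hy hx h)]
  · exact fun h => absurd hx h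

theorem sum_monomial_ne_zero_iff {σ α : Type*} {s : Finset α} {d : α → σ →₀ ℕ} {c : α → ℝ}
    (hd : Set.InjOn d s) (hc : ∀ x, c x ≠ 0) :
    ∑ x ∈ s, MvPolynomial.monomial (d x) (c x) ≠ 0 ↔ s.Nonempty := by
  refine ⟨Finset.nonempty_of_sum_ne_zero, fun ⟨x, hx⟩ h => hc x ?_⟩
  rw [← coeff_sum_monomial c hd hx, h, MvPolynomial.coeff_zero]

theorem isMonomialTerm_sum_monomial_iff {σ α : Type*} {s : Finset α} {d : α → σ →₀ ℕ}
    {c : α → ℝ} (hd : Set.InjOn d s) (hc : ∀ x, c x ≠ 0) :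
    IsMonomialTerm (∑ x ∈ s, MvPolynomial.monomial (d x) (c x)) ↔ ∃ x, s = {x} := by
  classical
  constructor
  · intro h
    obtain ⟨x, hx⟩ := (sum_monomial_ne_zero_iff hd hc).1 h.ne_zero
    obtain ⟨m, b, -, hm⟩ := h
    have key : ∀ y ∈ s, m = d y := fun y hy => by
      have h1 := coeff_sum_monomial c hd hy
      rw [hm, MvPolynomial.coeff_monomial] at h1
      by_contra hne
      rw [if_neg hne] at h1
      exact hc y h1.symm
    exact ⟨x, Finset.eq_singleton_iff_unique_mem.2
      ⟨hx, fun y hy => hd hy hx ((key y hy).symm.trans (key x hx))⟩⟩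
  · rintro ⟨x, rfl⟩
    rw [Finset.sum_singleton]
    exact isMonomialTerm_monomial _ (hc x)

/-- The summands have different multidegrees, so each nonzero one is a homogeneous component of the
sum. A single term has only one nonzero component, namely itself. -/
theorem isMonomialTerm_sum_iff {σ α M : Type*} [AddCommMonoid M] {w : σ → M} {s : Finset α}
    {Q : α → MvPolynomial σ ℝ} {m : α → M}
    (hQ : ∀ x ∈ s, MvPolynomial.IsWeightedHomogeneous w (Q x) (m x)) (hm : Set.InjOn m s) :
    IsMonomialTerm (∑ x ∈ s, Q x) ↔
      ∃ x ∈ s, IsMonomialTerm (Q x) ∧ ∀ y ∈ s, Q y ≠ 0 → y = x := by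
  classical
  constructor
  · intro h
    have hcomp : ∀ x ∈ s, MvPolynomial.weightedHomogeneousComponent w (m x) (∑ y ∈ s, Q y) =
        Q x := fun x hx => by
      rw [map_sum, Finset.sum_eq_single x]
      · exact (hQ x hx).weightedHomogeneousComponent_same
      · exact fun y hy hne => (hQ y hy).weightedHomogeneousComponent_ne _ fun h' =>
          hne (hm hy hx h'.symm)
      · exact fun h' => absurd hx h'
    obtain ⟨x, hx, hx0⟩ := Finset.exists_ne_zero_of_sum_ne_zero h.ne_zero
    have key : ∀ y ∈ s, Q y ≠ 0 → Q y = ∑ z ∈ s, Q z ∧ ∃ t c, c ≠ 0 ∧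
        ∑ z ∈ s, Q z = MvPolynomial.monomial t c ∧ Finsupp.weight w t = m y := fun y hy hy0 => by
      obtain ⟨t, c, hc, ht⟩ := h
      have hy1 := hcomp y hy
      have hw := MvPolynomial.isWeightedHomogeneous_monomial w t c (m := Finsupp.weight w t) rfl
      rw [← ht] at hw
      have hmy : Finsupp.weight w t = m y := by
        by_contra hne
        exact hy0 (hy1.symm.trans (hw.weightedHomogeneousComponent_ne _ (Ne.symm hne)))
      refine ⟨?_, t, c, hc, ht, hmy⟩
      rw [← hy1, ← hmy]
      exact hw.weightedHomogeneousComponent_same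
    refine ⟨x, hx, (key x hx hx0).1 ▸ h, fun y hy hy0 => ?_⟩
    have hw := hQ y hy
    rw [(key y hy hy0).1, ← (key x hx hx0).1] at hw
    exact hm hy hx (hw.inj_right hx0 (hQ x hx))
  · rintro ⟨x, hx, hQx, h⟩
    rw [Finset.sum_eq_single x]
    · exact hQx
    · exact fun y hy hne => by_contra fun h0 => hne (h y hy h0)
    · exact fun h' => absurd hx h'

/-! ### The expansion of the determinant -/

/-- The exponent of `∏ s ∈ S, ω_s`. -/
noncomputable def topExponent {V : Type*} (G : Digraph V) (S : Finset V) : Param G →₀ ℕ :=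
  ∑ s ∈ S, Finsupp.single (Param.omega s) 1

theorem topExponent_omega {V : Type*} {G : Digraph V} {S : Finset V} {v : V} :
    topExponent G S (Param.omega v) ≠ 0 ↔ v ∈ S := by
  classical
  rw [topExponent, Finsupp.finsetSum_apply, Ne, Finset.sum_eq_zero_iff]
  constructor
  · intro hne
    push Not at hne
    obtain ⟨u, hu, hu0⟩ := hne
    obtain rfl : u = v := by
      by_contra h
      exact hu0 (Finsupp.single_eq_of_ne fun h' => h (Param.omega.inj h').symm)
    exact hu
  · intro hv h0
    have := h0 v hv
    rw [Finsupp.single_eq_same] at this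
    exact one_ne_zero this

theorem monomial_topExponent {V : Type*} (G : Digraph V) (S : Finset V) :
    MvPolynomial.monomial (topExponent G S) (1 : ℝ) =
      ∏ s ∈ S, MvPolynomial.X (Param.omega s) :=
  MvPolynomial.monomial_sum_one S _

/-- The weight on the parameters that counts the occurrences of each `ω_v`. -/
noncomputable def omegaWeight {V : Type*} (G : Digraph V) : Param G → V →₀ ℕ
  | .omega v => Finsupp.single v 1
  | .lambda _ _ _ => 0

theorem weight_topExponent {V : Type*} (G : Digraph V) (S : Finset V) :
    Finsupp.weight (omegaWeight G) (topExponent G S) = ∑ s ∈ S, Finsupp.single s 1 := by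
  rw [topExponent, map_sum]
  refine Finset.sum_congr rfl fun s _ => ?_
  rw [Finsupp.weight_single, one_smul]
  rfl

theorem weight_edgeExponent {V : Type*} [Fintype V] (G : Digraph V) (f : V → V) :
    Finsupp.weight (omegaWeight G) (edgeExponent G f) = 0 := by
  classical
  rw [edgeExponent, map_sum]
  refine Finset.sum_eq_zero fun v _ => ?_
  split_ifs with h
  · rw [Finsupp.weight_single, one_smul]
    rfl
  · exact map_zero _

theorem sum_single_injective (V : Type*) :
    Function.Injective fun S : Finset V => ∑ s ∈ S, (Finsupp.single s 1 : V →₀ ℕ) := by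
  classical
  have h : ∀ (S : Finset V) (v : V), (∑ s ∈ S, (Finsupp.single s 1 : V →₀ ℕ)) v =
      if v ∈ S then 1 else 0 := fun S v => by
    simp [Finsupp.finsetSum_apply, Finsupp.single_apply]
  intro S T hST
  ext v
  have := DFunLike.congr_fun hST v
  simp only [h] at this
  by_cases h1 : v ∈ S <;> by_cases h2 : v ∈ T <;> simp_all

/-- The signed sum of the monomials of the linkages from `S` to `A`. -/
noncomputable def linkageSum {V : Type*} [Fintype V] (G : Digraph V) (S A : Finset V)
    (c : (V → V) → ℝ) : MvPolynomial (Param G) ℝ :=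
  ∑ f ∈ linkages G S A, MvPolynomial.monomial (edgeExponent G f) (c f)

theorem injOn_edgeExponent {V : Type*} [Fintype V] (G : Digraph V) (S A : Finset V) :
    Set.InjOn (edgeExponent G) (linkages G S A : Set (V → V)) := fun _ hf _ hg h =>
  (mem_linkages.1 hf).along.edgeExponent_inj (mem_linkages.1 hg).along h

theorem linkageSum_ne_zero_iff {V : Type*} [Fintype V] {G : Digraph V} {S A : Finset V}
    {c : (V → V) → ℝ} (hc : ∀ f, c f ≠ 0) :
    linkageSum G S A c ≠ 0 ↔ ∃ f, IsLinkage G S A f := by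
  rw [linkageSum, sum_monomial_ne_zero_iff (injOn_edgeExponent G S A) hc]
  simp only [Finset.Nonempty, mem_linkages]

theorem isMonomialTerm_linkageSum_iff {V : Type*} [Fintype V] {G : Digraph V} {S A : Finset V}
    {c : (V → V) → ℝ} (hc : ∀ f, c f ≠ 0) :
    IsMonomialTerm (linkageSum G S A c) ↔ ∃! f, IsLinkage G S A f := by
  rw [linkageSum, isMonomialTerm_sum_monomial_iff (injOn_edgeExponent G S A) hc]
  simp only [Finset.eq_singleton_iff_unique_mem, mem_linkages]
  rfl

theorem isWeightedHomogeneous_linkageSum {V : Type*} [Fintype V] (G : Digraph V) (S A : Finset V)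
    (c : (V → V) → ℝ) :
    MvPolynomial.IsWeightedHomogeneous (omegaWeight G) (linkageSum G S A c) 0 :=
  MvPolynomial.IsWeightedHomogeneous.sum _ _ _ fun f _ =>
    MvPolynomial.isWeightedHomogeneous_monomial _ _ _ (weight_edgeExponent G f)

/-- Sets of the wrong size get a constant map as junk value, which Cauchy–Binet never uses. -/
theorem exists_enumeration {V : Type*} [Nonempty V] [DecidableEq V] (ι : Type*) [Fintype ι] :
    ∃ e : Finset V → ι → V, ∀ S : Finset V, S.card = Fintype.card ι →
      Function.Injective (e S) ∧ Finset.univ.image (e S) = S := by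
  have h : ∀ S : Finset V, ∃ e : ι → V, S.card = Fintype.card ι →
      Function.Injective e ∧ Finset.univ.image e = S := by
    intro S
    by_cases hS : S.card = Fintype.card ι
    · have E : ι ≃ S := Fintype.equivOfCardEq (by rw [Fintype.card_coe, hS])
      refine ⟨fun k => E k, fun _ => ⟨Subtype.val_injective.comp E.injective, ?_⟩⟩
      ext v
      simp only [Finset.mem_image, Finset.mem_univ, true_and]
      exact ⟨fun ⟨k, hk⟩ => hk ▸ (E k).2, fun hv => ⟨E.symm ⟨v, hv⟩, by simp⟩⟩
    · exact ⟨fun _ => Classical.arbitrary V, fun h => absurd h hS⟩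
  choose e he using h
  exact ⟨e, he⟩

theorem injective_elim {V : Type*} {i : V} {K : Finset V} (hi : i ∉ K) :
    Function.Injective fun k : Option K => k.elim i Subtype.val := by
  rintro (_ | k) (_ | l) h
  · rfl
  · have h' : i = l := h
    exact absurd (h' ▸ l.2) hi
  · have h' : k = i := h
    exact absurd (h' ▸ k.2) hi
  · exact congrArg some (Subtype.ext h)

theorem image_elim {V : Type*} [DecidableEq V] (i : V) (K : Finset V) :
    (Finset.univ.image fun k : Option K => k.elim i Subtype.val) = insert i K := by
  ext v
  simp [Option.exists, eq_comm]

/-- Up to a unit, the minor of the covariance matrix is the sum over the sets `S` of top vertices of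
`∏ s ∈ S, ω_s` times the signed sums of the linkages from `S` to the two index sets. -/
theorem exists_phiStar_detSigma_eq {V : Type*} [Fintype V] [DecidableEq V] {G : Digraph V}
    (hG : IsDAG G) {i j : V} {K : Finset V} (hi : i ∉ K) (hj : j ∉ K) :
    ∃ (u : MvPolynomial (Param G) ℝ) (c d : Finset V → (V → V) → ℝ), IsUnit u ∧
      (∀ S f, c S f ≠ 0) ∧ (∀ S f, d S f ≠ 0) ∧ phiStar G (detSigma i j K) =
        u * ∑ S ∈ Finset.powersetCard (insert i K).card Finset.univ,
          MvPolynomial.monomial (topExponent G S) 1 * linkageSum G S (insert i K) (c S) *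
            linkageSum G S (insert j K) (d S) := by
  have : Nonempty V := ⟨i⟩
  obtain ⟨e, he⟩ := exists_enumeration (V := V) (Option K)
  have hcard : Fintype.card (Option K) = (insert i K).card := by
    rw [Fintype.card_option, Fintype.card_coe, Finset.card_insert_of_notMem hi]
  have key : ∀ v, v ∉ K → ∃ c : Finset V → (V → V) → ℝ, (∀ S f, c S f ≠ 0) ∧
      ∀ S : Finset V, S.card = Fintype.card (Option K) →
        ((pathSum G).submatrix (e S) fun k : Option K => k.elim v Subtype.val).det =
          linkageSum G S (insert v K) (c S) * (pathSum G).det := by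
    intro v hv
    have h : ∀ S : Finset V, ∃ c : (V → V) → ℝ, (∀ f, c f ≠ 0) ∧
        (S.card = Fintype.card (Option K) →
        ((pathSum G).submatrix (e S) fun k : Option K => k.elim v Subtype.val).det =
          linkageSum G S (insert v K) c * (pathSum G).det) := by
      intro S
      by_cases hS : S.card = Fintype.card (Option K)
      · obtain ⟨c, hc, hdet⟩ := det_pathSum_submatrix hG (he S hS).1 (injective_elim hv)
          (he S hS).2 (image_elim v K)
        exact ⟨c, hc, fun _ => hdet⟩
      · exact ⟨fun _ => 1, fun _ => one_ne_zero, fun h => absurd h hS⟩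
    choose c hc hdet using h
    exact ⟨c, hc, hdet⟩
  obtain ⟨c, hc, hdetc⟩ := key i hi
  obtain ⟨d, hd, hdetd⟩ := key j hj
  have hunit : IsUnit (pathSum G).det := by
    have h := congrArg Matrix.det (one_sub_mul_pathSum hG)
    rw [Matrix.det_mul, Matrix.det_one] at h
    exact IsUnit.of_mul_eq_one_right _ h
  refine ⟨(pathSum G).det * (pathSum G).det, c, d, hunit.mul hunit, hc, hd, ?_⟩
  rw [phiStar_detSigma, det_mul_eq_sum_powersetCard e he, hcard, Finset.mul_sum]
  refine Finset.sum_congr rfl fun S hS => ?_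
  have hScard : S.card = Fintype.card (Option K) := by
    rw [hcard, (Finset.mem_powersetCard.1 hS).2]
  -- The factors $\omega_s$ scale the columns indexed by $S$ and come out of the determinant.
  have h1 : ((Matrix.of fun (k : Option K) v =>
      MvPolynomial.X (Param.omega v) * pathSum G v (k.elim i Subtype.val)).submatrix id (e S)).det
      = MvPolynomial.monomial (topExponent G S) 1 *
        ((pathSum G).submatrix (e S) fun k : Option K => k.elim i Subtype.val).det := by
    have htop : ∏ s ∈ S, (MvPolynomial.X (Param.omega s) : MvPolynomial (Param G) ℝ) =
        ∏ k, MvPolynomial.X (Param.omega (e S k)) := by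
      rw [← Finset.prod_image (f := fun s => MvPolynomial.X (Param.omega s))
        (he S hScard).1.injOn, (he S hScard).2]
    rw [← Matrix.det_transpose ((pathSum G).submatrix _ _), monomial_topExponent, htop,
      ← Matrix.det_mul_row]
    rfl
  rw [h1, hdetc S hScard, Matrix.submatrix_submatrix, Function.id_comp, Function.comp_id,
    hdetd S hScard]
  ring

/-- The $\omega$-degree separates the summands, and each summand is a single term iff both of its
linkage sums are. Thus cancellation between pairs of linkages never has to be examined. -/
theorem isMonomialTerm_phiStar_detSigma_iff {V : Type*} [Fintype V] [DecidableEq V]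
    {G : Digraph V} (hG : IsDAG G) {i j : V} {K : Finset V} (hi : i ∉ K) (hj : j ∉ K) :
    IsMonomialTerm (phiStar G (detSigma i j K)) ↔
      ∃ S : Finset V, S.card = (insert i K).card ∧
        (∃! f, IsLinkage G S (insert i K : Finset V) f) ∧
        (∃! g, IsLinkage G S (insert j K : Finset V) g) ∧
        ∀ (S' : Finset V) (f g : V → V), S'.card = (insert i K).card →
          IsLinkage G S' (insert i K : Finset V) f → IsLinkage G S' (insert j K : Finset V) g →
          S' = S := by
  obtain ⟨u, c, d, hu, hc, hd, h⟩ := exists_phiStar_detSigma_eq hG hi hj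
  have hone : ∀ S, IsMonomialTerm (MvPolynomial.monomial (topExponent G S) (1 : ℝ)) :=
    fun S => isMonomialTerm_monomial _ one_ne_zero
  rw [h, isMonomialTerm_mul, and_iff_right hu.isMonomialTerm,
    isMonomialTerm_sum_iff (w := omegaWeight G) (m := fun S => ∑ s ∈ S, Finsupp.single s 1) ?_
      (sum_single_injective V).injOn]
  · simp only [Finset.mem_powersetCard, Finset.subset_univ, true_and, isMonomialTerm_mul, hone,
      isMonomialTerm_linkageSum_iff (hc _), isMonomialTerm_linkageSum_iff (hd _), mul_ne_zero_iff,
      linkageSum_ne_zero_iff (hc _), linkageSum_ne_zero_iff (hd _), (hone _).ne_zero, ne_eq,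
      not_false_eq_true, and_assoc]
    refine exists_congr fun S => and_congr_right fun _ => and_congr_right fun _ =>
      and_congr_right fun _ => ?_
    exact ⟨fun h S' f g hS' hf hg => h S' hS' ⟨⟨f, hf⟩, g, hg⟩,
      fun h S' hS' ⟨⟨f, hf⟩, g, hg⟩ => h S' f g hS' hf hg⟩
  · intro S _
    have h1 := MvPolynomial.isWeightedHomogeneous_monomial (omegaWeight G) (topExponent G S)
      (1 : ℝ) (weight_topExponent G S)
    have h2 := (h1.mul (isWeightedHomogeneous_linkageSum G S (insert i K) (c S))).mul
      (isWeightedHomogeneous_linkageSum G S (insert j K) (d S))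
    rwa [add_zero, add_zero] at h2

/-! ### The main theorem -/

theorem existsUnique_trekSystem_iff {V : Type*} [Fintype V] [DecidableEq V] {G : Digraph V}
    (hG : IsDAG G) {A B : Finset V} (hAB : A.card = B.card) :
    (∃! 𝒯 : Finset (Trek G), IsTrekSystem A B 𝒯 ∧ NoSidedIntersection 𝒯) ↔
      ∃ S : Finset V, S.card = A.card ∧ (∃! f, IsLinkage G S A f) ∧ (∃! g, IsLinkage G S B g) ∧
        ∀ (S' : Finset V) (f g : V → V), S'.card = A.card →
          IsLinkage G S' A f → IsLinkage G S' B g → S' = S := by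
  constructor
  · rintro ⟨𝒯, ⟨hT, hd⟩, huniq⟩
    obtain ⟨S, f, g, hS, hf, hg, henc⟩ := exists_encoding hG hT hd
    -- Every triple yields a system without sided intersection, which must be `𝒯`; so every triple
    -- encodes `𝒯`, and the encoding of a system is unique.
    have key : ∀ (S' : Finset V) (f' g' : V → V), S'.card = A.card → IsLinkage G S' A f' →
        IsLinkage G S' B g' → Encodes 𝒯 S' f' g' := fun S' f' g' hS' hf' hg' => by
      obtain ⟨𝒯', h'⟩ := exists_encodes hG S' hf'.along hg'.along
      rwa [← huniq 𝒯' ⟨h'.isTrekSystem hG hf' hg' hS' (hS'.trans hAB),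
        h'.noSidedIntersection hG hf' hg'⟩]
    refine ⟨S, hS, ⟨f, hf, fun f' hf' => ?_⟩, ⟨g, hg, fun g' hg' => ?_⟩,
      fun S' f' g' hS' hf' hg' => ?_⟩
    · exact (key S f' g hS hf' hg).left_unique hG henc hf' hf
    · exact (key S f g' hS hf hg').right_unique hG henc hg' hg
    · exact (key S' f' g' hS' hf' hg').image.symm.trans henc.image
  · rintro ⟨S, hS, ⟨f, hf, huf⟩, ⟨g, hg, hug⟩, huS⟩
    obtain ⟨𝒯, henc⟩ := exists_encodes hG S hf.along hg.along
    refine ⟨𝒯, ⟨henc.isTrekSystem hG hf hg hS (hS.trans hAB), henc.noSidedIntersection hG hf hg⟩,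
      fun 𝒯' ⟨hT', hd'⟩ => ?_⟩
    obtain ⟨S', f', g', hS', hf', hg', henc'⟩ := exists_encoding hG hT' hd'
    obtain rfl := huS S' f' g' hS' hf' hg'
    obtain rfl := huf f' hf'
    obtain rfl := hug g' hg'
    exact henc'.unique henc

theorem exists_trekSystem_weight_ne {V : Type*} [Fintype V] [DecidableEq V] {G : Digraph V}
    (hG : IsDAG G) {A B : Finset V} (hAB : A.card = B.card) {𝒯₁ 𝒯₂ : Finset (Trek G)}
    (h₁ : IsTrekSystem A B 𝒯₁) (hd₁ : NoSidedIntersection 𝒯₁) (h₂ : IsTrekSystem A B 𝒯₂)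
    (hd₂ : NoSidedIntersection 𝒯₂) (hne : 𝒯₁ ≠ 𝒯₂)
    (hw : trekSystemWeight 𝒯₁ = trekSystemWeight 𝒯₂) :
    ∃ 𝒯₃ : Finset (Trek G), IsTrekSystem A B 𝒯₃ ∧ NoSidedIntersection 𝒯₃ ∧
      trekSystemWeight 𝒯₃ ≠ trekSystemWeight 𝒯₁ := by
  obtain ⟨S, f, g, hS, hf, hg, henc⟩ := exists_encoding hG h₁ hd₁
  obtain ⟨S', f', g', hS', hf', hg', henc'⟩ := exists_encoding hG h₂ hd₂
  have hw₁ := henc.trekSystemWeight_eq hG hf hg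
  rw [hw₁, henc'.trekSystemWeight_eq hG hf' hg'] at hw
  have hexp : topExponent G S + edgeExponent G f + edgeExponent G g =
      topExponent G S' + edgeExponent G f' + edgeExponent G g' :=
    MvPolynomial.monomial_left_injective one_ne_zero hw
  -- Only the tops contribute variables $\omega_v$, so equal weights give equal sets of tops.
  obtain rfl : S = S' := by
    ext v
    have := DFunLike.congr_fun hexp (Param.omega v)
    simp only [Finsupp.add_apply, edgeExponent_omega, add_zero] at this
    rw [← topExponent_omega (G := G), this, topExponent_omega]
  -- Left parts of the first system with right parts of the second. If the weight were unchanged,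
  -- cancelling the common factors would give `g' = g`, then `f = f'`, and the two given systems
  -- would coincide.
  obtain ⟨𝒯₃, henc₃⟩ := exists_encodes hG S hf.along hg'.along
  refine ⟨𝒯₃, henc₃.isTrekSystem hG hf hg' hS (hS.trans hAB),
    henc₃.noSidedIntersection hG hf hg', fun h => hne ?_⟩
  rw [hw₁, henc₃.trekSystemWeight_eq hG hf hg'] at h
  have hgg : g' = g := hg'.along.edgeExponent_inj hg.along
    (add_left_cancel (MvPolynomial.monomial_left_injective one_ne_zero h))
  subst hgg
  have hff : f = f' := hf.along.edgeExponent_inj hf'.along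
    (add_left_cancel (add_right_cancel hexp))
  subst hff
  exact henc.unique henc'

/-- The equivalence and the existence of the third trek system hold for all `i`, `j` outside `K`;
neither `i ≠ j` nor the absence of `d`-separation is needed. -/
theorem mainTheorem5 {V : Type*} [Fintype V] [DecidableEq V] (G : Digraph V) (hG : IsDAG G)
    (i j : V) (K : Finset V) (hij : i ≠ j) (hiK : i ∉ K) (hjK : j ∉ K)
    (hsep : ¬ DSeparates G {i} {j} (K : Set V)) :
    (IsMonomialTerm (phiStar G (detSigma i j K)) ↔
      ∃! 𝒯 : Finset (Trek G),
        IsTrekSystem (insert i K) (insert j K) 𝒯 ∧ NoSidedIntersection 𝒯) ∧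
    (∀ 𝒯₁ 𝒯₂ : Finset (Trek G),
      IsTrekSystem (insert i K) (insert j K) 𝒯₁ → NoSidedIntersection 𝒯₁ →
      IsTrekSystem (insert i K) (insert j K) 𝒯₂ → NoSidedIntersection 𝒯₂ →
      𝒯₁ ≠ 𝒯₂ → trekSystemWeight 𝒯₁ = trekSystemWeight 𝒯₂ →
      ∃ 𝒯₃ : Finset (Trek G),
        IsTrekSystem (insert i K) (insert j K) 𝒯₃ ∧ NoSidedIntersection 𝒯₃ ∧
        trekSystemWeight 𝒯₃ ≠ trekSystemWeight 𝒯₁) := by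
  have hcard : (insert i K).card = (insert j K).card := by
    rw [Finset.card_insert_of_notMem hiK, Finset.card_insert_of_notMem hjK]
  refine ⟨?_, fun 𝒯₁ 𝒯₂ h₁ hd₁ h₂ hd₂ hne hw =>
    exists_trekSystem_weight_ne hG hcard h₁ hd₁ h₂ hd₂ hne hw⟩
  rw [isMonomialTerm_phiStar_detSigma_iff hG hiK hjK, existsUnique_trekSystem_iff hG hcard]
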